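/- Let $m\ge 1$ and let $H_1,\dots,H_m\in C^1(\mathbb R^m)$ be real-valued functions whose matrix of partial derivatives $(\partial_iH_j(v))_{i,j}$ is symmetric for every $v\in\mathbb R^m$. Let $\Phi:[0,\infty)\to\mathbb R$ be continuous with $\Phi(0)=0$ and of class $C^2$ on $(0,\infty)$, such that $\Phi(s)$, $\Phi'(s)$ and $\Phi'(s)+2s\Phi''(s)$ are positive for all $s>0$ and $s^2\Phi''(s)$ is bounded for $0<s\le 1$ (the last condition is automatic if $\Phi$ is $C^2$ on $[0,\infty)$, and it holds for $\Phi(s)=\frac2p s^{p/2}$, $p>1$). Let $u=(u_i)_{i=1}^m:\mathbb R^2\to\mathbb R^m$ be a bounded classical solution of $$-\operatorname{div}\big(\Phi'(|\nabla u_i|^2)\nabla u_i\big)=H_i(u)\quad\text{in }\mathbb R^2,\qquad i=1,\dots,m,$$ that is, $u_i$ and the vector field $\Phi'(|\nabla u_i|^2)\nabla u_i$ (understood as $0$ where $\nabla u_i=0$) are of class $C^1$ and the equations hold at every point. Suppose that $|\nabla u_i|\in L^\infty(\mathbb R^2)\cap W^{1,2}_{loc}(\mathbb R^2)$ for each $i$.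 For $\eta\in\mathbb R^2$ let $\mathcal A(\eta)$ be the matrix with entries $2\Phi''(|\eta|^2)\eta_k\eta_l+\Phi'(|\eta|^2)\delta_{kl}$; for $\eta=0$ this means $\Phi'(0)\delta_{kl}$, where $\Phi'(0)$ is the right derivative of $\Phi$ at $0$, replaced by $0$ if that derivative does not exist. Suppose that $u$ is stable: there are functions $\phi_1,\dots,\phi_m\in C^1(\mathbb R^2)$, each everywhere positive or everywhere negative, such that $\partial_jH_i(u)\phi_j\phi_i>0$ in $\mathbb R^2$ for all $i\ne j$ and, with $\mathcal A(\nabla u_i)\nabla\phi_i$ locally integrable, $$-\operatorname{div}\big(\mathcal A(\nabla u_i)\nabla\phi_i\big)=\sum_{j=1}^m\partial_jH_i(u)\,\phi_j\quad\text{in }\mathbb R^2,\qquad i=1,\dots,m,$$ in the sense of distributions. Then every $u_i$ is one-dimensional, with a common direction: there are $a\in\mathbb R^2$ with $|a|=1$ and functions $u_i^*:\mathbb R\to\mathbb R$ such that $u_i(x)=u_i^*(a\cdot x)$ for all $x\in\mathbb R^2$ and all $i$. Moreover, for all $i\neq j$ and every $x$ with $\nabla u_i(x)\ne0$ and $\nabla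 u_j(x)\neq 0$, the angle between $\nabla u_i(x)$ and $\nabla u_j(x)$ equals $$\arccos\left(\frac{|\partial_iH_j(u(x))|}{\partial_iH_j(u(x))}\right).$$ -/

import Mathlib

open MeasureTheory Set
open scoped ContDiff

namespace QuasilinearSystem

/-- `Φ'`, the derivative relative to `[0, ∞)`. At an interior point this is the usual derivative, at
`0` it is the right derivative (and `0` if `Φ` has no right derivative there). -/
noncomputable def D1 (Φ : ℝ → ℝ) (s : ℝ) : ℝ := derivWithin Φ (Ici 0) s

/-- `Φ''`, relative to `[0, ∞)`. -/
noncomputable def D2 (Φ : ℝ → ℝ) (s : ℝ) : ℝ := derivWithin (D1 Φ) (Ici 0) s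

/-- The structural assumptions on `Φ`. The last field is automatic if `Φ` is `C²` up to `0`; it
is required in place of that stronger property so that `Φ(s) = (2/p) s^(p/2)`, `p > 1`, is
admissible, too. -/
structure IsAdmissible (Φ : ℝ → ℝ) : Prop where
  continuousOn : ContinuousOn Φ (Ici 0)
  contDiffOn : ContDiffOn ℝ 2 Φ (Ioi 0)
  map_zero : Φ 0 = 0
  pos : ∀ s, 0 < s → 0 < Φ s
  deriv_pos : ∀ s, 0 < s → 0 < D1 Φ s
  elliptic : ∀ s, 0 < s → 0 < D1 Φ s + 2 * D2 Φ s * s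
  bounded_near_zero : ∃ C : ℝ, ∀ s, 0 < s → s ≤ 1 → |s ^ 2 * D2 Φ s| ≤ C

/-- The vector field `Φ'(|∇f|²) ∇f`. -/
noncomputable def flux {n : ℕ} (Φ : ℝ → ℝ) (f : EuclideanSpace ℝ (Fin n) → ℝ)
    (x : EuclideanSpace ℝ (Fin n)) : EuclideanSpace ℝ (Fin n) :=
  D1 Φ (‖gradient f x‖ ^ 2) • gradient f x

/-- The vector `𝒜(η) ξ`, where `𝒜(η)` is the matrix with the entries
`2 Φ''(|η|²) η_k η_l + Φ'(|η|²) δ_{kl}`. -/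
noncomputable def applyA {n : ℕ} (Φ : ℝ → ℝ) (η ξ : EuclideanSpace ℝ (Fin n)) :
    EuclideanSpace ℝ (Fin n) :=
  (2 * D2 Φ (‖η‖ ^ 2) * inner ℝ η ξ) • η + D1 Φ (‖η‖ ^ 2) • ξ

/-- The divergence `∑ₖ ∂ₖ Xₖ` of a (differentiable) vector field. -/
noncomputable def divergence {n : ℕ} (X : EuclideanSpace ℝ (Fin n) → EuclideanSpace ℝ (Fin n))
    (x : EuclideanSpace ℝ (Fin n)) : ℝ :=
  ∑ k : Fin n, fderiv ℝ X x (EuclideanSpace.single k 1) k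

/-- `-div V = g` in the sense of distributions. -/
def NegDivEqWeakly {n : ℕ} (V : EuclideanSpace ℝ (Fin n) → EuclideanSpace ℝ (Fin n))
    (g : EuclideanSpace ℝ (Fin n) → ℝ) : Prop :=
  LocallyIntegrable V volume ∧ LocallyIntegrable g volume ∧
    ∀ ζ : EuclideanSpace ℝ (Fin n) → ℝ, ContDiff ℝ ∞ ζ → HasCompactSupport ζ →
      ∫ x, inner ℝ (V x) (gradient ζ x) = ∫ x, g x * ζ x

/-- The local Sobolev space `W^{1,2}_loc(ℝⁿ)`, by a weak gradient `G`. -/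
def MemW12Loc {n : ℕ} (f : EuclideanSpace ℝ (Fin n) → ℝ) : Prop :=
  (∀ K : Set (EuclideanSpace ℝ (Fin n)), IsCompact K → MemLp f 2 (volume.restrict K)) ∧
    ∃ G : EuclideanSpace ℝ (Fin n) → EuclideanSpace ℝ (Fin n),
      (∀ K : Set (EuclideanSpace ℝ (Fin n)), IsCompact K → MemLp G 2 (volume.restrict K)) ∧
      ∀ ζ : EuclideanSpace ℝ (Fin n) → ℝ, ContDiff ℝ ∞ ζ → HasCompactSupport ζ →
        ∀ k : Fin n, ∫ x, f x * gradient ζ x k = - ∫ x, G x k * ζ x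

/-- The partial derivative `∂ⱼ h (v)` of a function on `ℝᵐ`. -/
noncomputable def partialDeriv {m : ℕ} (j : Fin m) (h : (Fin m → ℝ) → ℝ) (v : Fin m → ℝ) : ℝ :=
  fderiv ℝ h v (Pi.single j 1)

/-- The system with nonlinearity `H` is symmetric: the matrix `(∂ᵢ Hⱼ)` is symmetric. -/
def IsSymmetricSystem {m : ℕ} (H : Fin m → (Fin m → ℝ) → ℝ) : Prop :=
  ∀ (v : Fin m → ℝ) (i j : Fin m), partialDeriv i (H j) v = partialDeriv j (H i) v

/-- `u` solves `-div(Φ'(|∇uᵢ|²) ∇uᵢ) = Hᵢ(u)` in `ℝⁿ` classically: each `uᵢ` and each vector field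
`Φ'(|∇uᵢ|²) ∇uᵢ` is `C¹` and the equations hold at every point. (For `Φ` of class `C²` on `[0, ∞)`
this includes every `u` of class `C²` that satisfies the equations.) -/
def IsClassicalSolution {m n : ℕ} (Φ : ℝ → ℝ) (H : Fin m → (Fin m → ℝ) → ℝ)
    (u : Fin m → EuclideanSpace ℝ (Fin n) → ℝ) : Prop :=
  ∀ i : Fin m, ContDiff ℝ 1 (u i) ∧ ContDiff ℝ 1 (flux Φ (u i)) ∧
    ∀ x, - divergence (flux Φ (u i)) x = H i (fun k => u k x)

/-- Stability of a solution `u`: there are functions `φᵢ`, each of one strict sign, with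
`∂ⱼHᵢ(u) φⱼ φᵢ > 0` for `i ≠ j`, that solve the linearized system
`-div(𝒜(∇uᵢ) ∇φᵢ) = ∑ⱼ ∂ⱼHᵢ(u) φⱼ`. The `φᵢ` are `C¹` and the linearized system is understood in the
sense of distributions; this covers pointwise solutions for which `𝒜(∇uᵢ) ∇φᵢ` is `C¹`. -/
def IsStable {m n : ℕ} (Φ : ℝ → ℝ) (H : Fin m → (Fin m → ℝ) → ℝ)
    (u : Fin m → EuclideanSpace ℝ (Fin n) → ℝ) : Prop :=
  ∃ φ : Fin m → EuclideanSpace ℝ (Fin n) → ℝ,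
    (∀ i, ContDiff ℝ 1 (φ i)) ∧
    (∀ i, (∀ x, 0 < φ i x) ∨ (∀ x, φ i x < 0)) ∧
    (∀ i j, i ≠ j → ∀ x, 0 < partialDeriv j (H i) (fun k => u k x) * φ j x * φ i x) ∧
    ∀ i, NegDivEqWeakly (fun x => applyA Φ (gradient (u i) x) (gradient (φ i) x))
      (fun x => ∑ j : Fin m, partialDeriv j (H i) (fun k => u k x) * φ j x)

end QuasilinearSystem

namespace QuasilinearSystem

open Filter Topology

/-! The proof is a geometric Poincaré inequality, obtained by comparing stability with the
differentiated equation, and made decisive by the logarithmic cutoffs of the plane.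

Stability: testing the linearized equation for `φᵢ` with `ζᵢ² / φᵢ` (Picone) and adding over `i`
bounds a quadratic form with coefficients `∂ⱼHᵢ(u)` by `∑ᵢ ∫ 𝒜(∇uᵢ)∇ζᵢ · ∇ζᵢ`
(`stability_inequality`). The symmetry of the system and the sign condition turn the off-diagonal
terms into `|∂ⱼHᵢ(u)| |ζᵢ| |ζⱼ|`.

Equation: differentiating the equation for `uᵢ` in direction `eₖ`, testing with `∂ₖuᵢ τ²` and adding
over `k` gives an identity for the Hessian energy (`integral_hessianEnergy_mul_sq`). In the plane
this energy splits into a part normal to the level curves, which is that of `|∇uᵢ|`, and a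
tangential part (`hessianEnergy_eq`).

With `ζᵢ = |∇uᵢ| τ` the normal parts and the cross terms cancel. What remains (`geometric_poincare`)
is that the tangential energies plus the defects `|∂ⱼHᵢ| |∇uᵢ| |∇uⱼ| - ∂ⱼHᵢ ∇uᵢ · ∇uⱼ`, all
nonnegative, have weighted integrals at most `C ∫ |∇η|²`. Here `|∇uᵢ|² 𝒜(∇uᵢ)` is bounded because
`|∇uᵢ|` is. Cutoffs `η` of arbitrarily small Dirichlet energy (`exists_cutoff`) make all these
quantities vanish.

Since `𝒜` is definite, `∇uᵢ` then does not change along its level curve, hence is constant along a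
whole straight line orthogonal to it (`eq_along_rot`). Vanishing defects make the gradients of
different components parallel, with cosine equal to the sign of `∂ⱼHᵢ`. Two nonparallel gradients at
different points would have lines that meet, and the gradients at the meeting point contradict this;
so all gradients are multiples of one vector (`exists_direction`).

Critical points need care, as `𝒜` may degenerate or blow up there and `∇uᵢ` need not be
differentiable. All test functions are therefore cut off where `|∇uᵢ|` is small (`truncation`), and
this cutoff is removed in the limit. -/

theorem D1_eventuallyEq_deriv (Φ : ℝ → ℝ) {s : ℝ} (hs : 0 < s) : D1 Φ =ᶠ[𝓝 s] deriv Φ := by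
  filter_upwards [Ioi_mem_nhds hs] with t ht
  exact derivWithin_of_mem_nhds (Ici_mem_nhds ht)

theorem D2_eq_deriv (Φ : ℝ → ℝ) {s : ℝ} (hs : 0 < s) : D2 Φ s = deriv (D1 Φ) s :=
  derivWithin_of_mem_nhds (Ici_mem_nhds hs)

/-! ### Bounds for the derivatives of `Φ` near zero. -/

namespace IsAdmissible

variable {Φ : ℝ → ℝ}

theorem contDiffAt_D1 (hΦ : IsAdmissible Φ) {s : ℝ} (hs : 0 < s) : ContDiffAt ℝ 1 (D1 Φ) s := by
  have h : ContDiffOn ℝ 1 (deriv Φ) (Ioi 0) :=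
    hΦ.contDiffOn.deriv_of_isOpen isOpen_Ioi (by norm_num)
  exact (h.contDiffAt (Ioi_mem_nhds hs)).congr_of_eventuallyEq (D1_eventuallyEq_deriv Φ hs)

theorem hasDerivAt_D1 (hΦ : IsAdmissible Φ) {s : ℝ} (hs : 0 < s) :
    HasDerivAt (D1 Φ) (D2 Φ s) s := by
  rw [D2_eq_deriv Φ hs]
  exact ((hΦ.contDiffAt_D1 hs).differentiableAt (by norm_num)).hasDerivAt

theorem continuousAt_D2 (hΦ : IsAdmissible Φ) {s : ℝ} (hs : 0 < s) : ContinuousAt (D2 Φ) s := by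
  have h : ContinuousAt (deriv (D1 Φ)) s := by
    have h1 : ContDiffOn ℝ 1 (D1 Φ) (Ioi 0) := fun t ht => (hΦ.contDiffAt_D1 ht).contDiffWithinAt
    exact (h1.continuousOn_deriv_of_isOpen isOpen_Ioi le_rfl).continuousAt (Ioi_mem_nhds hs)
  refine h.congr ?_
  filter_upwards [Ioi_mem_nhds hs] with t ht using (D2_eq_deriv Φ ht).symm

/-- The derivative of `s Φ'(s)²` is `Φ' (Φ' + 2 s Φ'')`, so ellipticity is exactly what gives
monotonicity. -/
theorem mul_sq_D1_mono (hΦ : IsAdmissible Φ) :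
    MonotoneOn (fun s => s * D1 Φ s ^ 2) (Ioi 0) := by
  have hd : ∀ s ∈ Ioi (0 : ℝ), HasDerivAt (fun s => s * D1 Φ s ^ 2)
      (D1 Φ s * (D1 Φ s + 2 * D2 Φ s * s)) s := by
    intro s hs
    have h := (hasDerivAt_id s).mul ((hΦ.hasDerivAt_D1 hs).pow 2)
    refine h.congr_deriv ?_
    simp only [id, Nat.cast_ofNat, Pi.pow_apply]
    ring
  refine monotoneOn_of_deriv_nonneg (convex_Ioi 0)
    (fun s hs => (hd s hs).continuousAt.continuousWithinAt)
    (fun s hs => (hd s (interior_subset hs)).differentiableAt.differentiableWithinAt)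
    fun s hs => ?_
  have hs' : s ∈ Ioi (0 : ℝ) := interior_subset hs
  rw [(hd s hs').deriv]
  exact mul_nonneg (hΦ.deriv_pos s hs').le (hΦ.elliptic s hs').le

/-- `(s Φ'(s))² = s · (s Φ'(s)²)`, and both factors are largest at `s = L`. So `s Φ'(s)` stays
bounded even where `Φ'` blows up at `0`. -/
theorem exists_mul_D1_le (hΦ : IsAdmissible Φ) (L : ℝ) :
    ∃ C, ∀ s, 0 < s → s ≤ L → s * D1 Φ s ≤ C := by
  refine ⟨L * D1 Φ L, fun s hs hsL => ?_⟩
  have hL : 0 < L := hs.trans_le hsL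
  have h1 := hΦ.mul_sq_D1_mono (mem_Ioi.2 hs) (mem_Ioi.2 hL) hsL
  have h2 := mul_le_mul hsL h1 (by positivity) hL.le
  refine abs_le_of_sq_le_sq' ?_ (mul_nonneg hL.le (hΦ.deriv_pos L hL).le) |>.2
  simp only at h2
  nlinarith

theorem exists_sq_mul_D2_le (hΦ : IsAdmissible Φ) (L : ℝ) :
    ∃ C, ∀ s, 0 < s → s ≤ L → |s ^ 2 * D2 Φ s| ≤ C := by
  obtain ⟨C, hC⟩ := hΦ.bounded_near_zero
  have hcont : ContinuousOn (fun s => s ^ 2 * D2 Φ s) (Icc 1 L) := fun s hs =>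
    ((continuousAt_id.pow 2).mul
      (hΦ.continuousAt_D2 (zero_lt_one.trans_le hs.1))).continuousWithinAt
  obtain ⟨C', hC'⟩ := isCompact_Icc.exists_bound_of_continuousOn hcont
  refine ⟨max C C', fun s hs hsL => ?_⟩
  rcases le_total s 1 with h | h
  · exact (hC s hs h).trans (le_max_left _ _)
  · exact (hC' s ⟨h, hsL⟩).trans (le_max_right _ _)

end IsAdmissible

/-! ### The matrix `𝒜(η)`: definiteness, weighted bounds and its role as a Jacobian. -/

/-- The matrix `𝒜(η)` as a continuous linear map. -/
noncomputable def coeffA {n : ℕ} (Φ : ℝ → ℝ) (η : EuclideanSpace ℝ (Fin n)) :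
    EuclideanSpace ℝ (Fin n) →L[ℝ] EuclideanSpace ℝ (Fin n) :=
  (2 * D2 Φ (‖η‖ ^ 2)) • (innerSL ℝ η).smulRight η +
    D1 Φ (‖η‖ ^ 2) • ContinuousLinearMap.id ℝ _

section coeffA

variable {n : ℕ} {Φ : ℝ → ℝ}

theorem coeffA_apply (η ξ : EuclideanSpace ℝ (Fin n)) : coeffA Φ η ξ = applyA Φ η ξ := by
  simp [coeffA, applyA, smul_smul]

theorem inner_coeffA (η ξ ζ : EuclideanSpace ℝ (Fin n)) :
    inner ℝ (coeffA Φ η ξ) ζ =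
      2 * D2 Φ (‖η‖ ^ 2) * inner ℝ η ξ * inner ℝ η ζ + D1 Φ (‖η‖ ^ 2) * inner ℝ ξ ζ := by
  simp [coeffA_apply, applyA, inner_add_left, inner_smul_left]

theorem inner_coeffA_comm (η ξ ζ : EuclideanSpace ℝ (Fin n)) :
    inner ℝ (coeffA Φ η ξ) ζ = inner ℝ (coeffA Φ η ζ) ξ := by
  rw [inner_coeffA, inner_coeffA, real_inner_comm ξ ζ]
  ring

/-- The eigenvalues are `Φ'` and `Φ' + 2 s Φ''` with `s = |η|²`. The first bounds the form below
when `Φ'' ≥ 0`; the second does so, by Cauchy–Schwarz, when `Φ'' ≤ 0`. -/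
theorem inner_coeffA_self_pos (hΦ : IsAdmissible Φ) {η ξ : EuclideanSpace ℝ (Fin n)}
    (hη : η ≠ 0) (hξ : ξ ≠ 0) : 0 < inner ℝ (coeffA Φ η ξ) ξ := by
  have hs : 0 < ‖η‖ ^ 2 := by positivity
  have hx : 0 < ‖ξ‖ ^ 2 := by positivity
  have h1 := hΦ.deriv_pos _ hs
  have h2 := hΦ.elliptic _ hs
  have hcs : inner ℝ η ξ ^ 2 ≤ ‖η‖ ^ 2 * ‖ξ‖ ^ 2 := by
    have := sq_le_sq' (by linarith [neg_abs_le (inner ℝ η ξ), abs_real_inner_le_norm η ξ])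
      ((le_abs_self _).trans (abs_real_inner_le_norm η ξ))
    linarith [mul_pow ‖η‖ ‖ξ‖ 2]
  rw [inner_coeffA, real_inner_self_eq_norm_sq]
  rcases le_total 0 (D2 Φ (‖η‖ ^ 2)) with h | h
  · have : 0 ≤ D2 Φ (‖η‖ ^ 2) * inner ℝ η ξ ^ 2 := by positivity
    nlinarith [mul_pos h1 hx]
  · nlinarith [mul_le_mul_of_nonpos_left hcs h, mul_pos h2 hx]

theorem inner_coeffA_self_nonneg (hΦ : IsAdmissible Φ) {η : EuclideanSpace ℝ (Fin n)}
    (hη : η ≠ 0) (ξ : EuclideanSpace ℝ (Fin n)) : 0 ≤ inner ℝ (coeffA Φ η ξ) ξ := by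
  rcases eq_or_ne ξ 0 with rfl | h
  · simp
  · exact (inner_coeffA_self_pos hΦ hη h).le

/-- The weight `|η|²` compensates the singularity at `0`: only `s² Φ''(s)` and `s Φ'(s)` enter. This
is the sole source of the constant in the Poincaré inequality. -/
theorem exists_sq_norm_mul_inner_coeffA_le (hΦ : IsAdmissible Φ) (K : ℝ) :
    ∃ C, 0 ≤ C ∧ ∀ η : EuclideanSpace ℝ (Fin n), η ≠ 0 → ‖η‖ ≤ K →
      ∀ ξ : EuclideanSpace ℝ (Fin n), ‖η‖ ^ 2 * inner ℝ (coeffA Φ η ξ) ξ ≤ C * ‖ξ‖ ^ 2 := by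
  obtain ⟨C₁, h₁⟩ := hΦ.exists_mul_D1_le (K ^ 2)
  obtain ⟨C₂, h₂⟩ := hΦ.exists_sq_mul_D2_le (K ^ 2)
  refine ⟨|2 * C₂ + C₁|, abs_nonneg _, fun η hη hK ξ => ?_⟩
  have hs : 0 < ‖η‖ ^ 2 := by positivity
  have hsK : ‖η‖ ^ 2 ≤ K ^ 2 := by gcongr
  have hcs : inner ℝ η ξ ^ 2 ≤ ‖η‖ ^ 2 * ‖ξ‖ ^ 2 := by
    have := sq_le_sq' (by linarith [neg_abs_le (inner ℝ η ξ), abs_real_inner_le_norm η ξ])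
      ((le_abs_self _).trans (abs_real_inner_le_norm η ξ))
    linarith [mul_pow ‖η‖ ‖ξ‖ 2]
  have e1 : ‖η‖ ^ 2 * D2 Φ (‖η‖ ^ 2) * inner ℝ η ξ ^ 2 ≤ C₂ * ‖ξ‖ ^ 2 := by
    calc _ ≤ |‖η‖ ^ 2 * D2 Φ (‖η‖ ^ 2)| * inner ℝ η ξ ^ 2 :=
          mul_le_mul_of_nonneg_right (le_abs_self _) (sq_nonneg _)
      _ ≤ |‖η‖ ^ 2 * D2 Φ (‖η‖ ^ 2)| * (‖η‖ ^ 2 * ‖ξ‖ ^ 2) := by gcongr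
      _ = |(‖η‖ ^ 2) ^ 2 * D2 Φ (‖η‖ ^ 2)| * ‖ξ‖ ^ 2 := by
          rw [abs_mul, abs_mul, abs_of_pos hs, abs_of_pos (pow_pos hs 2)]; ring
      _ ≤ C₂ * ‖ξ‖ ^ 2 := by gcongr; exact h₂ _ hs hsK
  have e2 : ‖η‖ ^ 2 * D1 Φ (‖η‖ ^ 2) * ‖ξ‖ ^ 2 ≤ C₁ * ‖ξ‖ ^ 2 := by
    gcongr; exact h₁ _ hs hsK
  have e3 : (2 * C₂ + C₁) * ‖ξ‖ ^ 2 ≤ |2 * C₂ + C₁| * ‖ξ‖ ^ 2 := by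
    gcongr; exact le_abs_self _
  rw [inner_coeffA, real_inner_self_eq_norm_sq]
  linarith

theorem continuousAt_coeffA (hΦ : IsAdmissible Φ) {η : EuclideanSpace ℝ (Fin n)} (hη : η ≠ 0) :
    ContinuousAt (coeffA (n := n) Φ) η := by
  have hs : 0 < ‖η‖ ^ 2 := by positivity
  have hn : ContinuousAt (fun η : EuclideanSpace ℝ (Fin n) => ‖η‖ ^ 2) η := by fun_prop
  have h2 := (hΦ.continuousAt_D2 hs).comp_of_eq hn rfl
  have h1 := ((hΦ.contDiffAt_D1 hs).continuousAt).comp_of_eq hn rfl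
  have h3 : Continuous fun η : EuclideanSpace ℝ (Fin n) => (innerSL ℝ η).smulRight η := by
    fun_prop
  exact ((continuousAt_const.mul h2).smul h3.continuousAt).add (h1.smul continuousAt_const)

theorem contDiffAt_norm_sq_smul (hΦ : IsAdmissible Φ) {η : EuclideanSpace ℝ (Fin n)}
    (hη : η ≠ 0) :
    ContDiffAt ℝ 1 (fun η : EuclideanSpace ℝ (Fin n) => D1 Φ (‖η‖ ^ 2) • η) η := by
  have hs : 0 < ‖η‖ ^ 2 := by positivity
  have hn : ContDiffAt ℝ 1 (fun η : EuclideanSpace ℝ (Fin n) => ‖η‖ ^ 2) η :=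
    (contDiff_norm_sq ℝ).contDiffAt
  exact ((hΦ.contDiffAt_D1 hs).comp η hn).smul contDiffAt_id

/-- Identifies `𝒜(η)` as the Jacobian of `η ↦ Φ'(|η|²) η`; hence the derivative of the flux is
`𝒜(∇f) D²f`. -/
theorem hasFDerivAt_norm_sq_smul (hΦ : IsAdmissible Φ) {η : EuclideanSpace ℝ (Fin n)}
    (hη : η ≠ 0) :
    HasFDerivAt (fun η : EuclideanSpace ℝ (Fin n) => D1 Φ (‖η‖ ^ 2) • η) (coeffA Φ η) η := by
  have hs : 0 < ‖η‖ ^ 2 := by positivity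
  have hn : HasFDerivAt (fun η : EuclideanSpace ℝ (Fin n) => ‖η‖ ^ 2) (2 • innerSL ℝ η) η :=
    (hasStrictFDerivAt_norm_sq η).hasFDerivAt
  have h := ((hΦ.hasDerivAt_D1 hs).comp_hasFDerivAt η hn).smul (hasFDerivAt_id η)
  refine h.congr_fderiv ?_
  ext1 ξ
  simp only [coeffA, Function.comp_apply, id, add_apply,
    smul_apply, ContinuousLinearMap.smulRight_apply, nsmul_eq_mul,
    innerSL_apply_apply, ContinuousLinearMap.id_apply, smul_smul, smul_eq_mul, Nat.cast_ofNat]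
  rw [add_comm]
  congr 2
  ring

/-- `𝒜(η)` as a linear isomorphism, for `η ≠ 0`. -/
noncomputable def equivA (hΦ : IsAdmissible Φ) {η : EuclideanSpace ℝ (Fin n)} (hη : η ≠ 0) :
    EuclideanSpace ℝ (Fin n) ≃L[ℝ] EuclideanSpace ℝ (Fin n) :=
  (LinearEquiv.ofInjectiveEndo (coeffA Φ η).toLinearMap <|
    (injective_iff_map_eq_zero _).2 fun ξ hξ => by
      by_contra h
      have := inner_coeffA_self_pos hΦ hη h
      rw [show coeffA Φ η ξ = 0 from hξ, inner_zero_left] at this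
      exact lt_irrefl _ this).toContinuousLinearEquiv

theorem coe_equivA (hΦ : IsAdmissible Φ) {η : EuclideanSpace ℝ (Fin n)} (hη : η ≠ 0) :
    (equivA hΦ hη : EuclideanSpace ℝ (Fin n) →L[ℝ] EuclideanSpace ℝ (Fin n)) = coeffA Φ η := by
  ext1 ξ
  rfl

end coeffA

/-! ### Regularity of the gradient away from critical points. -/

section regularity

variable {n : ℕ} {Φ : ℝ → ℝ} {f : EuclideanSpace ℝ (Fin n) → ℝ}

/-- The inner product as a (linear, not conjugate-linear) map into the dual space. -/
noncomputable def innerCLM (n : ℕ) :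
    EuclideanSpace ℝ (Fin n) →L[ℝ] EuclideanSpace ℝ (Fin n) →L[ℝ] ℝ :=
  innerSL ℝ

theorem innerCLM_apply (v w : EuclideanSpace ℝ (Fin n)) : innerCLM n v w = inner ℝ v w := rfl

theorem fderiv_eq_innerCLM_gradient (f : EuclideanSpace ℝ (Fin n) → ℝ) :
    fderiv ℝ f = fun x => innerCLM n (gradient f x) := by
  ext x v
  rw [innerCLM_apply, inner_gradient_left]

theorem gradient_apply (f : EuclideanSpace ℝ (Fin n) → ℝ) (x : EuclideanSpace ℝ (Fin n))
    (k : Fin n) : gradient f x k = fderiv ℝ f x (EuclideanSpace.single k 1) := by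
  rw [← inner_gradient_left, EuclideanSpace.inner_single_right]
  simp

theorem continuous_gradient (hf : ContDiff ℝ 1 f) : Continuous (gradient f) :=
  (InnerProductSpace.toDual ℝ _).symm.continuous.comp (hf.continuous_fderiv (by norm_num))

/-- The flux is `F ∘ ∇f` with `F(η) = Φ'(|η|²) η`, a local diffeomorphism away from `0`. Composing
the `C¹` flux with the local inverse of `F` recovers `∇f`, whose continuity keeps it in the domain
of that inverse. -/
theorem contDiffAt_gradient (hΦ : IsAdmissible Φ) (hf : ContDiff ℝ 1 f)
    (hX : ContDiff ℝ 1 (flux Φ f)) {x : EuclideanSpace ℝ (Fin n)} (hx : gradient f x ≠ 0) :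
    ContDiffAt ℝ 1 (gradient f) x := by
  have hF := contDiffAt_norm_sq_smul hΦ hx
  have hF' := hasFDerivAt_norm_sq_smul hΦ hx
  rw [← coe_equivA hΦ hx] at hF'
  have hinv := hF.to_localInverse hF' (by norm_num)
  refine (ContDiffAt.comp x (f := flux Φ f) hinv hX.contDiffAt).congr_of_eventuallyEq ?_
  have := (hF.hasStrictFDerivAt' hF' (by norm_num)).eventually_left_inverse
  filter_upwards [(continuous_gradient hf).continuousAt.eventually this] with y hy
  exact hy.symm

theorem fderiv_flux (hΦ : IsAdmissible Φ) (hf : ContDiff ℝ 1 f)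
    (hX : ContDiff ℝ 1 (flux Φ f)) {x : EuclideanSpace ℝ (Fin n)} (hx : gradient f x ≠ 0)
    (v : EuclideanSpace ℝ (Fin n)) :
    fderiv ℝ (flux Φ f) x v = coeffA Φ (gradient f x) (fderiv ℝ (gradient f) x v) := by
  have h := (hasFDerivAt_norm_sq_smul hΦ hx).comp x
    ((contDiffAt_gradient hΦ hf hX hx).differentiableAt (by norm_num)).hasFDerivAt
  have h' : HasFDerivAt (flux Φ f)
    ((coeffA Φ (gradient f x)).comp (fderiv ℝ (gradient f) x)) x := h
  rw [h'.fderiv]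
  rfl

theorem inner_fderiv_gradient_comm (hf : ContDiff ℝ 1 f) {x : EuclideanSpace ℝ (Fin n)}
    (hx : DifferentiableAt ℝ (gradient f) x) (v w : EuclideanSpace ℝ (Fin n)) :
    inner ℝ (fderiv ℝ (gradient f) x v) w = inner ℝ (fderiv ℝ (gradient f) x w) v := by
  have h2 : HasFDerivAt (fderiv ℝ f) ((innerCLM n).comp (fderiv ℝ (gradient f) x)) x := by
    rw [fderiv_eq_innerCLM_gradient]
    exact (innerCLM n).hasFDerivAt.comp x hx.hasFDerivAt
  exact second_derivative_symmetric
    (fun y => (hf.differentiable (by norm_num) y).hasFDerivAt) h2 v w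

theorem contDiffAt_norm_gradient (hΦ : IsAdmissible Φ) (hf : ContDiff ℝ 1 f)
    (hX : ContDiff ℝ 1 (flux Φ f)) {x : EuclideanSpace ℝ (Fin n)} (hx : gradient f x ≠ 0) :
    ContDiffAt ℝ 1 (fun y => ‖gradient f y‖) x :=
  (contDiffAt_gradient hΦ hf hX hx).norm ℝ hx

/-- Differentiating `|∇f|²` in two ways, together with the symmetry of the Hessian. -/
theorem gradient_norm_gradient (hf : ContDiff ℝ 1 f) {x : EuclideanSpace ℝ (Fin n)}
    (hx : gradient f x ≠ 0) (hd : DifferentiableAt ℝ (gradient f) x) :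
    gradient (fun y => ‖gradient f y‖) x =
      ‖gradient f x‖⁻¹ • fderiv ℝ (gradient f) x (gradient f x) := by
  have hw : DifferentiableAt ℝ (fun y => ‖gradient f y‖) x := hd.norm ℝ hx
  have h1 := hw.hasFDerivAt.pow 2
  have h2 := hd.hasFDerivAt.norm_sq
  have h3 := h1.unique h2
  refine ext_inner_right ℝ fun v => ?_
  have h4 := DFunLike.congr_fun h3 v
  have hx' : ‖gradient f x‖ ≠ 0 := norm_ne_zero_iff.2 hx
  simp at h4
  rw [inner_gradient_left, inner_smul_left, inner_fderiv_gradient_comm hf hd, real_inner_comm]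
  simp
  field_simp
  linarith

end regularity

/-! ### Distributional equations: `C¹` test functions and differentiation. -/

section weak

variable {n : ℕ}

theorem continuous_toDual_symm :
    Continuous fun L : EuclideanSpace ℝ (Fin n) →L[ℝ] ℝ =>
      (InnerProductSpace.toDual ℝ (EuclideanSpace ℝ (Fin n))).symm L :=
  (InnerProductSpace.toDual ℝ _).symm.continuous

theorem norm_gradient (f : EuclideanSpace ℝ (Fin n) → ℝ) (x : EuclideanSpace ℝ (Fin n)) :
    ‖gradient f x‖ = ‖fderiv ℝ f x‖ :=
  (InnerProductSpace.toDual ℝ _).symm.norm_map _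

theorem hasCompactSupport_gradient {f : EuclideanSpace ℝ (Fin n) → ℝ}
    (hf : HasCompactSupport f) : HasCompactSupport (gradient f) := by
  refine (hf.fderiv (𝕜 := ℝ)).mono fun x hx => ?_
  rw [Function.mem_support] at hx ⊢
  intro h
  apply hx
  rw [← norm_eq_zero, norm_gradient, h, norm_zero]

/-- Mollification with radius at most `1`, so that all supports stay in the closed unit
neighbourhood `K` of the support of `ψ`. The common `K` and `C` serve as the domination needed
against merely locally integrable fields. -/
theorem exists_contDiff_approx {ψ : EuclideanSpace ℝ (Fin n) → ℝ} (hψ : ContDiff ℝ 1 ψ)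
    (hc : HasCompactSupport ψ) :
    ∃ (K : Set (EuclideanSpace ℝ (Fin n))) (C : ℝ) (ρ : ℕ → EuclideanSpace ℝ (Fin n) → ℝ),
      IsCompact K ∧ (∀ k, ContDiff ℝ ∞ (ρ k)) ∧ (∀ k, HasCompactSupport (ρ k)) ∧
      (∀ k, ∀ x ∉ K, ρ k x = 0 ∧ gradient (ρ k) x = 0) ∧
      (∀ k x, |ρ k x| ≤ C ∧ ‖gradient (ρ k) x‖ ≤ C) ∧
      ∀ x, Tendsto (fun k => ρ k x) atTop (𝓝 (ψ x)) ∧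
        Tendsto (fun k => gradient (ρ k) x) atTop (𝓝 (gradient ψ x)) := by
  let φ : ℕ → ContDiffBump (0 : EuclideanSpace ℝ (Fin n)) := fun k =>
    ⟨1 / (k + 1) / 2, 1 / (k + 1), half_pos Nat.one_div_pos_of_nat,
      half_lt_self Nat.one_div_pos_of_nat⟩
  have hφ : Tendsto (fun k => (φ k).rOut) atTop (𝓝 0) := tendsto_one_div_add_atTop_nhds_zero_nat
  let ρ : ℕ → EuclideanSpace ℝ (Fin n) → ℝ := fun k =>
    convolution ((φ k).normed volume) ψ (ContinuousLinearMap.lsmul ℝ ℝ) volume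
  have hψ' : Continuous (fderiv ℝ ψ) := hψ.continuous_fderiv (by norm_num)
  have hfd : ∀ k x, fderiv ℝ (ρ k) x =
      convolution ((φ k).normed volume) (fderiv ℝ ψ) (ContinuousLinearMap.lsmul ℝ ℝ) volume x := by
    intro k x
    have h := hc.hasFDerivAt_convolution_right (μ := volume) (ContinuousLinearMap.lsmul ℝ ℝ)
      (ContDiffBump.continuous_normed (μ := volume) (φ k)).locallyIntegrable hψ x
    exact h.fderiv
  have hcK : IsCompact (Metric.cthickening 1 (tsupport ψ)) := hc.isCompact.cthickening
  have hzero : ∀ k, ∀ x ∉ Metric.cthickening 1 (tsupport ψ), ρ k x = 0 := by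
    intro k x hx
    have h0 : ∀ y ∈ Metric.ball x 1, ψ y = 0 := by
      intro y hy
      by_contra hne
      exact hx (Metric.mem_cthickening_of_dist_le x y 1 _ (subset_tsupport ψ hne)
        (by rw [dist_comm]; exact (Metric.mem_ball.1 hy).le))
    have hle : (φ k).rOut ≤ 1 := by
      change 1 / ((k : ℝ) + 1) ≤ 1
      rw [div_le_one (by positivity)]
      linarith [(Nat.cast_nonneg k : (0 : ℝ) ≤ k)]
    have hx0 : ψ x = 0 := h0 x (Metric.mem_ball_self one_pos)
    have h : dist (ρ k x) (ψ x) ≤ 0 :=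
      (φ k).dist_normed_convolution_le hψ.continuous.aestronglyMeasurable fun y hy => by
        rw [h0 y (Metric.ball_subset_ball hle hy), hx0, dist_self]
    rw [hx0] at h
    exact dist_le_zero.1 h
  obtain ⟨C₁, hC₁⟩ := hψ.continuous.bounded_above_of_compact_support hc
  obtain ⟨C₂, hC₂⟩ := hψ'.bounded_above_of_compact_support (hc.fderiv (𝕜 := ℝ))
  -- The mollified value is an average of values of norm at most `C`, hence within `2 C` of the
  -- value at the centre; this gives the crude bound `3 C`.
  have hbound : ∀ {F : Type} [NormedAddCommGroup F] (a b : F) (C : ℝ), ‖b‖ ≤ C →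
      dist a b ≤ 2 * C → ‖a‖ ≤ 3 * C := fun a b C h1 h2 => by
    have := norm_sub_norm_le a b
    rw [dist_eq_norm] at h2
    linarith
  have hdist : ∀ {F : Type} [NormedAddCommGroup F] (a b : F) (C : ℝ), ‖a‖ ≤ C → ‖b‖ ≤ C →
      dist a b ≤ 2 * C := fun a b C h1 h2 => by
    have := dist_le_norm_add_norm a b
    linarith
  refine ⟨Metric.cthickening 1 (tsupport ψ), max (3 * C₁) (3 * C₂), ρ, hcK, fun k => ?_,
    fun k => ?_, fun k x hx => ⟨hzero k x hx, ?_⟩, fun k x => ⟨?_, ?_⟩, fun x => ⟨?_, ?_⟩⟩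
  · exact (φ k).hasCompactSupport_normed.contDiff_convolution_left _ (φ k).contDiff_normed
      hψ.continuous.locallyIntegrable
  · exact HasCompactSupport.intro hcK (hzero k)
  · have : ρ k =ᶠ[𝓝 x] fun _ => 0 := by
      filter_upwards [Metric.isClosed_cthickening.isOpen_compl.mem_nhds hx] with y hy
      exact hzero k y hy
    rw [this.gradient_eq, gradient_fun_const]
  · refine le_trans ?_ (le_max_left _ _)
    exact hbound (ρ k x) (ψ x) C₁ (hC₁ x) <|
      (φ k).dist_normed_convolution_le hψ.continuous.aestronglyMeasurable fun y _ =>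
        hdist _ _ _ (hC₁ y) (hC₁ x)
  · refine le_trans ?_ (le_max_right _ _)
    rw [norm_gradient, hfd]
    refine hbound _ (fderiv ℝ ψ x) C₂ (hC₂ x) <|
      (φ k).dist_normed_convolution_le hψ'.aestronglyMeasurable fun y _ =>
        hdist _ _ _ (hC₂ y) (hC₂ x)
  · exact ContDiffBump.convolution_tendsto_right_of_continuous hφ hψ.continuous x
  · have h := ContDiffBump.convolution_tendsto_right_of_continuous (μ := volume) hφ hψ' x
    simp only [← hfd] at h
    exact (continuous_toDual_symm.tendsto _).comp h

/-- Functions that are only `C¹` are admissible in the distributional formulation. -/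
theorem NegDivEqWeakly.integral_eq {V : EuclideanSpace ℝ (Fin n) → EuclideanSpace ℝ (Fin n)}
    {g : EuclideanSpace ℝ (Fin n) → ℝ} (h : NegDivEqWeakly V g)
    {ψ : EuclideanSpace ℝ (Fin n) → ℝ} (hψ : ContDiff ℝ 1 ψ) (hc : HasCompactSupport ψ) :
    ∫ x, inner ℝ (V x) (gradient ψ x) = ∫ x, g x * ψ x := by
  obtain ⟨hV, hg, htest⟩ := h
  obtain ⟨K, C, ρ, hK, hsm, hcs, hzero, hbd, hlim⟩ := exists_contDiff_approx hψ hc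
  have hVK : Integrable (K.indicator fun x => ‖V x‖ * C) :=
    (integrable_indicator_iff hK.measurableSet).2 ((hV.integrableOn_isCompact hK).norm.mul_const C)
  have hgK : Integrable (K.indicator fun x => ‖g x‖ * C) :=
    (integrable_indicator_iff hK.measurableSet).2 ((hg.integrableOn_isCompact hK).norm.mul_const C)
  have h1 : Tendsto (fun k => ∫ x, inner ℝ (V x) (gradient (ρ k) x)) atTop
      (𝓝 (∫ x, inner ℝ (V x) (gradient ψ x))) := by
    refine tendsto_integral_of_dominated_convergence _ (fun k => ?_) hVK
      (fun k => Eventually.of_forall fun x => ?_) (Eventually.of_forall fun x => ?_)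
    · exact hV.aestronglyMeasurable.inner
        (continuous_gradient ((hsm k).of_le (by norm_num))).aestronglyMeasurable
    · by_cases hx : x ∈ K
      · rw [indicator_of_mem hx]
        exact (norm_inner_le_norm _ _).trans
          (mul_le_mul_of_nonneg_left (hbd k x).2 (norm_nonneg _))
      · rw [indicator_of_notMem hx, (hzero k x hx).2, inner_zero_right, norm_zero]
    · exact tendsto_const_nhds.inner (hlim x).2
  have h2 : Tendsto (fun k => ∫ x, g x * ρ k x) atTop (𝓝 (∫ x, g x * ψ x)) := by
    refine tendsto_integral_of_dominated_convergence _ (fun k => ?_) hgK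
      (fun k => Eventually.of_forall fun x => ?_) (Eventually.of_forall fun x => ?_)
    · exact hg.aestronglyMeasurable.mul (hsm k).continuous.aestronglyMeasurable
    · by_cases hx : x ∈ K
      · rw [indicator_of_mem hx, norm_mul]
        exact mul_le_mul_of_nonneg_left (hbd k x).1 (norm_nonneg _)
      · rw [indicator_of_notMem hx, (hzero k x hx).1, mul_zero, norm_zero]
    · exact tendsto_const_nhds.mul (hlim x).1
  refine tendsto_nhds_unique h1 (h2.congr fun k => ?_)
  exact (htest (ρ k) (hsm k) (hcs k)).symm

/-- Integration by parts against a compactly supported function. -/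
theorem integral_mul_fderiv_eq_neg {a b : EuclideanSpace ℝ (Fin n) → ℝ} (ha : ContDiff ℝ 1 a)
    (hb : ContDiff ℝ 1 b) (hc : HasCompactSupport b) (v : EuclideanSpace ℝ (Fin n)) :
    ∫ x, a x * fderiv ℝ b x v = -∫ x, fderiv ℝ a x v * b x := by
  have ha' : Continuous fun x => fderiv ℝ a x v :=
    (ha.continuous_fderiv (by norm_num)).clm_apply continuous_const
  have hb' : Continuous fun x => fderiv ℝ b x v :=
    (hb.continuous_fderiv (by norm_num)).clm_apply continuous_const
  have hcb' : HasCompactSupport fun x => fderiv ℝ b x v :=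
    (hc.fderiv (𝕜 := ℝ)).comp_left (g := fun L : _ →L[ℝ] ℝ => L v) rfl
  refine integral_mul_fderiv_eq_neg_fderiv_mul_of_integrable ?_ ?_ ?_
    (fun x _ => ha.differentiable (by norm_num) x) fun x _ => hb.differentiable (by norm_num) x
  · exact (ha'.mul hb.continuous).integrable_of_hasCompactSupport hc.mul_left
  · exact (ha.continuous.mul hb').integrable_of_hasCompactSupport hcb'.mul_left
  · exact (ha.continuous.mul hb.continuous).integrable_of_hasCompactSupport hc.mul_left

theorem fderiv_coord {X : EuclideanSpace ℝ (Fin n) → EuclideanSpace ℝ (Fin n)}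
    {x : EuclideanSpace ℝ (Fin n)} (hX : DifferentiableAt ℝ X x) (k : Fin n)
    (v : EuclideanSpace ℝ (Fin n)) : fderiv ℝ (fun y => X y k) x v = fderiv ℝ X x v k := by
  have h := (EuclideanSpace.proj k : EuclideanSpace ℝ (Fin n) →L[ℝ] ℝ).hasFDerivAt.comp x
    hX.hasFDerivAt
  have h' : HasFDerivAt (fun y => X y k)
    ((EuclideanSpace.proj k : EuclideanSpace ℝ (Fin n) →L[ℝ] ℝ).comp (fderiv ℝ X x)) x := h
  rw [h'.fderiv]
  rfl

theorem inner_eq_sum_mul (v w : EuclideanSpace ℝ (Fin n)) : inner ℝ v w = ∑ k, v k * w k := by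
  simp [PiLp.inner_apply, mul_comm]

/-- The equation `-div X = g` may be differentiated. -/
theorem negDivEqWeakly_fderiv {X : EuclideanSpace ℝ (Fin n) → EuclideanSpace ℝ (Fin n)}
    {g : EuclideanSpace ℝ (Fin n) → ℝ} (hX : ContDiff ℝ 1 X) (hg : ContDiff ℝ 1 g)
    (h : ∀ x, -divergence X x = g x) (v : EuclideanSpace ℝ (Fin n)) :
    NegDivEqWeakly (fun x => fderiv ℝ X x v) (fun x => fderiv ℝ g x v) := by
  have hX' : Continuous fun x => fderiv ℝ X x v :=
    (hX.continuous_fderiv (by norm_num)).clm_apply continuous_const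
  have hg' : Continuous fun x => fderiv ℝ g x v :=
    (hg.continuous_fderiv (by norm_num)).clm_apply continuous_const
  refine ⟨hX'.locallyIntegrable, hg'.locallyIntegrable, fun ζ hζ hc => ?_⟩
  have hXk : ∀ k, ContDiff ℝ 1 fun x => X x k := fun k => (contDiff_euclidean.1 hX) k
  have hζ₂ : ContDiff ℝ 2 ζ := contDiff_infty.1 hζ 2
  have hζ' : ∀ w, ContDiff ℝ 1 fun x => fderiv ℝ ζ x w := fun w =>
    (hζ₂.fderiv_right (m := 1) (by norm_num)).clm_apply contDiff_const
  have hcζ : ∀ w, HasCompactSupport fun x => fderiv ℝ ζ x w := fun w =>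
    (hc.fderiv (𝕜 := ℝ)).comp_left (g := fun L : _ →L[ℝ] ℝ => L w) rfl
  have hsymm : ∀ x w, fderiv ℝ (fun y => fderiv ℝ ζ y w) x v =
      fderiv ℝ (fun y => fderiv ℝ ζ y v) x w := by
    intro x w
    have hd : DifferentiableAt ℝ (fderiv ℝ ζ) x :=
      (hζ₂.fderiv_right (m := 1) (by norm_num)).differentiable (by norm_num) x
    rw [fderiv_clm_apply hd (differentiableAt_const w),
      fderiv_clm_apply hd (differentiableAt_const v)]
    simpa using second_derivative_symmetric
      (fun y => (hζ.differentiable (by norm_num) y).hasFDerivAt) hd.hasFDerivAt v w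
  calc ∫ x, inner ℝ (fderiv ℝ X x v) (gradient ζ x)
      = ∫ x, ∑ k, fderiv ℝ (fun y => X y k) x v *
          fderiv ℝ ζ x (EuclideanSpace.single k 1) := by
        refine integral_congr_ae (Eventually.of_forall fun x => ?_)
        simp only [inner_eq_sum_mul, gradient_apply,
          fderiv_coord (hX.differentiable (by norm_num) x)]
    _ = ∑ k, ∫ x, fderiv ℝ (fun y => X y k) x v *
          fderiv ℝ ζ x (EuclideanSpace.single k 1) := by
        refine integral_finsetSum _ fun k _ => ?_
        exact ((((hXk k).continuous_fderiv (by norm_num)).clm_apply continuous_const).mul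
          (hζ' _).continuous).integrable_of_hasCompactSupport (hcζ _).mul_left
    _ = ∑ k, ∫ x, fderiv ℝ (fun y => X y k) x (EuclideanSpace.single k 1) *
          fderiv ℝ ζ x v := by
        refine Finset.sum_congr rfl fun k _ => ?_
        -- `X` is only `C¹`, so `∂ᵥ` is first moved onto `∂ₖζ`; the second derivatives of `ζ`
        -- commute, and `∂ₖ` is then moved back onto `X`.
        rw [← neg_inj, ← integral_mul_fderiv_eq_neg (hXk k) (hζ' _) (hcζ _),
          ← integral_mul_fderiv_eq_neg (hXk k) (hζ' _) (hcζ _)]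
        simp only [hsymm]
    _ = ∫ x, ∑ k, fderiv ℝ (fun y => X y k) x (EuclideanSpace.single k 1) *
          fderiv ℝ ζ x v := by
        refine (integral_finsetSum _ fun k _ => ?_).symm
        exact ((((hXk k).continuous_fderiv (by norm_num)).clm_apply continuous_const).mul
          (hζ' _).continuous).integrable_of_hasCompactSupport (hcζ _).mul_left
    _ = -∫ x, g x * fderiv ℝ ζ x v := by
        rw [← integral_neg]
        refine integral_congr_ae (Eventually.of_forall fun x => ?_)
        simp only [← h x, divergence, ← fderiv_coord (hX.differentiable (by norm_num) x),
          neg_mul, neg_neg, Finset.sum_mul]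
    _ = ∫ x, fderiv ℝ g x v * ζ x := by
        rw [integral_mul_fderiv_eq_neg hg (hζ.of_le (by norm_num)) hc, neg_neg]

end weak

/-! ### The energy identity from the differentiated equation. -/

section energyIdentity

variable {n : ℕ} {Φ : ℝ → ℝ} {f : EuclideanSpace ℝ (Fin n) → ℝ}

theorem contDiff_mul_of_tsupport {a b : EuclideanSpace ℝ (Fin n) → ℝ} (hb : ContDiff ℝ 1 b)
    (ha : ∀ x ∈ tsupport b, ContDiffAt ℝ 1 a x) : ContDiff ℝ 1 fun x => a x * b x := by
  refine contDiff_iff_contDiffAt.2 fun x => ?_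
  by_cases hx : x ∈ tsupport b
  · exact (ha x hx).mul hb.contDiffAt
  · refine contDiffAt_const (c := (0 : ℝ)) |>.congr_of_eventuallyEq ?_
    filter_upwards [notMem_tsupport_iff_eventuallyEq.1 hx] with y hy
    simp [hy]

theorem fderiv_eq_zero_of_notMem_tsupport {b : EuclideanSpace ℝ (Fin n) → ℝ}
    {x : EuclideanSpace ℝ (Fin n)} (hx : x ∉ tsupport b) : fderiv ℝ b x = 0 := by
  rw [(notMem_tsupport_iff_eventuallyEq.1 hx).fderiv_eq]
  exact fderiv_const_apply 0

/-- The quantity `∑ₖ 𝒜(∇f)∇∂ₖf · ∇∂ₖf`. -/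
noncomputable def hessianEnergy (Φ : ℝ → ℝ) (f : EuclideanSpace ℝ (Fin n) → ℝ)
    (x : EuclideanSpace ℝ (Fin n)) : ℝ :=
  ∑ k, inner ℝ (fderiv ℝ (flux Φ f) x (EuclideanSpace.single k 1))
    (fderiv ℝ (gradient f) x (EuclideanSpace.single k 1))

theorem sum_smul_single (v : EuclideanSpace ℝ (Fin n)) :
    ∑ k, v k • EuclideanSpace.single k (1 : ℝ) = v := by
  simpa using (EuclideanSpace.basisFun (Fin n) ℝ).sum_repr v

theorem continuousAt_fderiv_gradient (hΦ : IsAdmissible Φ) (hf : ContDiff ℝ 1 f)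
    (hX : ContDiff ℝ 1 (flux Φ f)) {x : EuclideanSpace ℝ (Fin n)} (hx : gradient f x ≠ 0) :
    ContinuousAt (fderiv ℝ (gradient f)) x :=
  (contDiffAt_gradient hΦ hf hX hx).continuousAt_fderiv (by norm_num)

theorem continuousAt_hessianEnergy (hΦ : IsAdmissible Φ) (hf : ContDiff ℝ 1 f)
    (hX : ContDiff ℝ 1 (flux Φ f)) {x : EuclideanSpace ℝ (Fin n)} (hx : gradient f x ≠ 0) :
    ContinuousAt (hessianEnergy Φ f) x := by
  refine tendsto_finsetSum _ fun k _ => ?_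
  exact ((hX.continuous_fderiv (by norm_num)).clm_apply continuous_const).continuousAt.inner
    ((continuousAt_fderiv_gradient hΦ hf hX hx).clm_apply continuousAt_const)

/-- Test the equation differentiated along `eₖ` with `∂ₖf τ²` and add over `k`. Keeping `tsupport τ`
away from the critical points makes this test function `C¹`. -/
theorem integral_hessianEnergy_mul_sq (hΦ : IsAdmissible Φ) (hf : ContDiff ℝ 1 f)
    (hX : ContDiff ℝ 1 (flux Φ f)) {g : EuclideanSpace ℝ (Fin n) → ℝ} (hg : ContDiff ℝ 1 g)
    (hfg : ∀ x, -divergence (flux Φ f) x = g x) {τ : EuclideanSpace ℝ (Fin n) → ℝ}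
    (hτ : ContDiff ℝ 1 τ) (hc : HasCompactSupport τ) (hs : ∀ x ∈ tsupport τ, gradient f x ≠ 0) :
    ∫ x, (hessianEnergy Φ f x * τ x ^ 2 +
        2 * τ x * fderiv ℝ τ x (fderiv ℝ (flux Φ f) x (gradient f x))) =
      ∫ x, fderiv ℝ g x (gradient f x) * τ x ^ 2 := by
  have hτ2 : ContDiff ℝ 1 fun x => τ x ^ 2 := hτ.pow 2
  have hts : tsupport (fun x => τ x ^ 2) ⊆ tsupport τ := by
    refine closure_mono fun x hx => ?_
    simpa using hx
  have hG : ∀ x ∈ tsupport τ, ∀ k, ContDiffAt ℝ 1 (fun y => gradient f y k) x := fun x hx k =>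
    contDiffAt_euclidean.1 (contDiffAt_gradient hΦ hf hX (hs x hx)) k
  have hψ : ∀ k, ContDiff ℝ 1 fun x => gradient f x k * τ x ^ 2 := fun k =>
    contDiff_mul_of_tsupport hτ2 fun x hx => hG x (hts hx) k
  have hcψ : ∀ k, HasCompactSupport fun x => gradient f x k * τ x ^ 2 := fun k =>
    HasCompactSupport.mul_left (hc.of_isClosed_subset (isClosed_tsupport _) hts)
  have hX' : ∀ v, Continuous fun x => fderiv ℝ (flux Φ f) x v := fun v =>
    (hX.continuous_fderiv (by norm_num)).clm_apply continuous_const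
  have hg' : ∀ v, Continuous fun x => fderiv ℝ g x v := fun v =>
    (hg.continuous_fderiv (by norm_num)).clm_apply continuous_const
  have hweak : ∀ k, ∫ x, inner ℝ (fderiv ℝ (flux Φ f) x (EuclideanSpace.single k 1))
        (gradient (fun x => gradient f x k * τ x ^ 2) x) =
      ∫ x, fderiv ℝ g x (EuclideanSpace.single k 1) * (gradient f x k * τ x ^ 2) := fun k =>
    (negDivEqWeakly_fderiv hX hg hfg _).integral_eq (hψ k) (hcψ k)
  have hL : ∀ k, Integrable fun x => inner ℝ (fderiv ℝ (flux Φ f) x (EuclideanSpace.single k 1))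
      (gradient (fun x => gradient f x k * τ x ^ 2) x) := fun k => by
    refine ((hX' _).inner (continuous_gradient (hψ k))).integrable_of_hasCompactSupport ?_
    refine (hasCompactSupport_gradient (hcψ k)).mono fun x hx => ?_
    rw [Function.mem_support] at hx ⊢
    exact fun h => hx (by rw [h, inner_zero_right])
  have hR : ∀ k, Integrable fun x =>
      fderiv ℝ g x (EuclideanSpace.single k 1) * (gradient f x k * τ x ^ 2) := fun k =>
    ((hg' _).mul (hψ k).continuous).integrable_of_hasCompactSupport (hcψ k).mul_left
  calc ∫ x, (hessianEnergy Φ f x * τ x ^ 2 +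
          2 * τ x * fderiv ℝ τ x (fderiv ℝ (flux Φ f) x (gradient f x)))
      = ∫ x, ∑ k, inner ℝ (fderiv ℝ (flux Φ f) x (EuclideanSpace.single k 1))
          (gradient (fun x => gradient f x k * τ x ^ 2) x) := by
        refine integral_congr_ae (Eventually.of_forall fun x => ?_)
        simp only [inner_gradient_right, RCLike.conj_to_real]
        by_cases hx : x ∈ tsupport τ
        · have hd : DifferentiableAt ℝ (gradient f) x :=
            (contDiffAt_gradient hΦ hf hX (hs x hx)).differentiableAt (by norm_num)
          have hterm : ∀ k v, fderiv ℝ (fun x => gradient f x k * τ x ^ 2) x v =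
              inner ℝ v (fderiv ℝ (gradient f) x (EuclideanSpace.single k 1)) * τ x ^ 2 +
                2 * τ x * (gradient f x k * fderiv ℝ τ x v) := by
            intro k v
            rw [fderiv_fun_mul ((hG x hx k).differentiableAt (by norm_num))
              (hτ2.differentiable (by norm_num) x),
              fderiv_fun_pow 2 (hτ.differentiable (by norm_num) x)]
            have h1 : inner ℝ v (fderiv ℝ (gradient f) x (EuclideanSpace.single k 1)) =
                fderiv ℝ (gradient f) x v k := by
              rw [real_inner_comm, inner_fderiv_gradient_comm hf hd,
                EuclideanSpace.inner_single_right]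
              simp
            simp [h1, fderiv_coord hd]
            ring
          simp only [hterm, Finset.sum_add_distrib, ← Finset.mul_sum, ← Finset.sum_mul,
            hessianEnergy]
          congr 2
          conv_lhs => rw [← sum_smul_single (gradient f x)]
          simp only [map_sum, map_smul, smul_eq_mul]
        · have h0 : τ x = 0 := image_eq_zero_of_notMem_tsupport hx
          have h1 : ∀ k, fderiv ℝ (fun x => gradient f x k * τ x ^ 2) x = 0 := fun k => by
            refine fderiv_eq_zero_of_notMem_tsupport fun h => hx ?_
            exact hts (closure_mono (Function.support_mul_subset_right _ _) h)
          simp [h0, h1]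
    _ = ∑ k, ∫ x, inner ℝ (fderiv ℝ (flux Φ f) x (EuclideanSpace.single k 1))
          (gradient (fun x => gradient f x k * τ x ^ 2) x) := integral_finsetSum _ fun k _ => hL k
    _ = ∑ k, ∫ x, fderiv ℝ g x (EuclideanSpace.single k 1) * (gradient f x k * τ x ^ 2) :=
        Finset.sum_congr rfl fun k _ => hweak k
    _ = ∫ x, ∑ k, fderiv ℝ g x (EuclideanSpace.single k 1) * (gradient f x k * τ x ^ 2) :=
        (integral_finsetSum _ fun k _ => hR k).symm
    _ = ∫ x, fderiv ℝ g x (gradient f x) * τ x ^ 2 := by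
        refine integral_congr_ae (Eventually.of_forall fun x => ?_)
        dsimp only
        conv_rhs => rw [← sum_smul_single (gradient f x)]
        simp only [map_sum, map_smul, smul_eq_mul, Finset.sum_mul]
        exact Finset.sum_congr rfl fun k _ => by ring

end energyIdentity

/-! ### Picone's inequality and the stability inequality. -/

section stability

variable {n : ℕ} {Φ : ℝ → ℝ} {f : EuclideanSpace ℝ (Fin n) → ℝ}

/-- The coefficients and energies are known to be continuous only off the critical set; a localized
integrand is nevertheless continuous everywhere. -/
theorem continuous_of_forall_mem_tsupport {F τ : EuclideanSpace ℝ (Fin n) → ℝ}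
    (h0 : ∀ x ∉ tsupport τ, F x = 0) (h1 : ∀ x ∈ tsupport τ, ContinuousAt F x) :
    Continuous F := by
  have hsub : tsupport F ⊆ tsupport τ := closure_minimal
    (fun x hx => by_contra fun h => hx (h0 x h)) (isClosed_tsupport _)
  exact continuous_of_tsupport fun x hx => h1 x (hsub hx)

theorem integrable_of_forall_mem_tsupport {F τ : EuclideanSpace ℝ (Fin n) → ℝ}
    (hc : HasCompactSupport τ) (h0 : ∀ x ∉ tsupport τ, F x = 0)
    (h1 : ∀ x ∈ tsupport τ, ContinuousAt F x) : Integrable F :=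
  (continuous_of_forall_mem_tsupport h0 h1).integrable_of_hasCompactSupport <|
    HasCompactSupport.intro hc.isCompact h0

theorem gradient_eq_zero_of_notMem_tsupport {b : EuclideanSpace ℝ (Fin n) → ℝ}
    {x : EuclideanSpace ℝ (Fin n)} (hx : x ∉ tsupport b) : gradient b x = 0 := by
  rw [← norm_eq_zero, norm_gradient, fderiv_eq_zero_of_notMem_tsupport hx, norm_zero]

theorem continuousAt_coeffA_gradient (hΦ : IsAdmissible Φ) (hf : ContDiff ℝ 1 f)
    {x : EuclideanSpace ℝ (Fin n)} (hx : gradient f x ≠ 0) :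
    ContinuousAt (fun y => coeffA Φ (gradient f y)) x :=
  (continuousAt_coeffA hΦ hx).comp (continuous_gradient hf).continuousAt

theorem integrable_inner_coeffA_gradient (hΦ : IsAdmissible Φ) (hf : ContDiff ℝ 1 f)
    {ζ : EuclideanSpace ℝ (Fin n) → ℝ} (hζ : ContDiff ℝ 1 ζ) (hc : HasCompactSupport ζ)
    (hs : ∀ x ∈ tsupport ζ, gradient f x ≠ 0) :
    Integrable fun x => inner ℝ (coeffA Φ (gradient f x) (gradient ζ x)) (gradient ζ x) := by
  refine integrable_of_forall_mem_tsupport hc (fun x hx => ?_) fun x hx => ?_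
  · rw [gradient_eq_zero_of_notMem_tsupport hx, inner_zero_right]
  · have h := (continuous_gradient hζ).continuousAt (x := x)
    exact ((continuousAt_coeffA_gradient hΦ hf (hs x hx)).clm_apply h).inner h

/-- Picone's inequality: testing with `ζ² / φ`. -/
theorem integral_mul_sq_div_le (hΦ : IsAdmissible Φ) (hf : ContDiff ℝ 1 f)
    {φ g ζ : EuclideanSpace ℝ (Fin n) → ℝ} (hφ : ContDiff ℝ 1 φ) (hφ0 : ∀ x, φ x ≠ 0)
    (hφg : NegDivEqWeakly (fun x => applyA Φ (gradient f x) (gradient φ x)) g)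
    (hζ : ContDiff ℝ 1 ζ) (hc : HasCompactSupport ζ)
    (hs : ∀ x ∈ tsupport ζ, gradient f x ≠ 0) :
    ∫ x, g x * (ζ x ^ 2 / φ x) ≤
      ∫ x, inner ℝ (coeffA Φ (gradient f x) (gradient ζ x)) (gradient ζ x) := by
  have hψ : ContDiff ℝ 1 fun x => ζ x ^ 2 / φ x := (hζ.pow 2).div hφ hφ0
  have hcψ : HasCompactSupport fun x => ζ x ^ 2 / φ x := by
    refine hc.mono fun x hx h => hx ?_
    simp [h]
  have hts : tsupport (fun x => ζ x ^ 2 / φ x) ⊆ tsupport ζ := by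
    refine closure_mono fun x hx h => hx ?_
    simp [h]
  have hdψ : ∀ x v, fderiv ℝ (fun x => ζ x ^ 2 / φ x) x v =
      2 * (ζ x / φ x) * fderiv ℝ ζ x v - (ζ x / φ x) ^ 2 * fderiv ℝ φ x v := by
    intro x v
    have h1 := (hζ.differentiable (by norm_num) x).hasFDerivAt.pow 2
    have h2 := (hφ.differentiable (by norm_num) x).hasFDerivAt
    have h3 := h1.mul ((hasDerivAt_inv (hφ0 x)).comp_hasFDerivAt x h2)
    have h4 : HasFDerivAt (fun x => ζ x ^ 2 * (φ x)⁻¹) _ x := h3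
    simp only [div_eq_mul_inv]
    rw [h4.fderiv]
    have := hφ0 x
    simp
    field_simp
    ring
  rw [← hφg.integral_eq hψ hcψ]
  simp only [← coeffA_apply]
  refine integral_mono_ae ?_ (integrable_inner_coeffA_gradient hΦ hf hζ hc hs)
    (Eventually.of_forall fun x => ?_)
  · refine integrable_of_forall_mem_tsupport hc (fun x hx => ?_) fun x hx => ?_
    · rw [gradient_eq_zero_of_notMem_tsupport fun h => hx (hts h), inner_zero_right]
    · exact ((continuousAt_coeffA_gradient hΦ hf (hs x hx)).clm_apply
        (continuous_gradient hφ).continuousAt).inner (continuous_gradient hψ).continuousAt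
  · dsimp only
    by_cases hx : x ∈ tsupport ζ
    · have hpos := inner_coeffA_self_nonneg hΦ (hs x hx)
        (gradient ζ x - (ζ x / φ x) • gradient φ x)
      rw [inner_gradient_right, RCLike.conj_to_real, hdψ]
      simp only [← inner_gradient_left]
      simp only [map_sub, map_smul, inner_sub_left, inner_sub_right, inner_smul_left,
        inner_smul_right, RCLike.conj_to_real] at hpos
      rw [inner_coeffA_comm _ (gradient ζ x) (gradient φ x)] at hpos
      rw [real_inner_comm _ (gradient ζ x), real_inner_comm _ (gradient φ x)]
      nlinarith
    · rw [gradient_eq_zero_of_notMem_tsupport fun h => hx (hts h),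
        gradient_eq_zero_of_notMem_tsupport hx, inner_zero_right, inner_zero_right]

/-- The coefficients `p = a r / s` and `q = a s / r` are positive with `p q = a²`, so this is `p y²
+ q z² ≥ 2 √(p q) |y| |z|`. -/
theorem two_mul_abs_le_of_pos {a r s y z : ℝ} (hr : r ≠ 0) (hs : s ≠ 0) (h : 0 < a * r * s) :
    2 * (|a| * |y| * |z|) ≤ a * r * (y ^ 2 / s) + a * s * (z ^ 2 / r) := by
  have hp : 0 < a * r / s := by
    have : a * r / s = a * r * s / s ^ 2 := by field_simp
    rw [this]; positivity
  have hq : 0 < a * s / r := by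
    have : a * s / r = a * r * s / r ^ 2 := by field_simp
    rw [this]; positivity
  have hpq : (a * r / s) * (a * s / r) = a ^ 2 := by field_simp
  have e : a * r * (y ^ 2 / s) + a * s * (z ^ 2 / r) =
      (a * r / s) * y ^ 2 + (a * s / r) * z ^ 2 := by ring
  rw [e]
  refine abs_le_of_sq_le_sq' ?_ (by positivity) |>.2
  have h2 : (2 * (|a| * |y| * |z|)) ^ 2 = 4 * ((a * r / s) * (a * s / r)) * (y ^ 2 * z ^ 2) := by
    rw [hpq, mul_pow, mul_pow, mul_pow, sq_abs, sq_abs, sq_abs]; ring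
  rw [h2]
  nlinarith [sq_nonneg ((a * r / s) * y ^ 2 - (a * s / r) * z ^ 2)]

/-- The stability inequality. -/
theorem stability_inequality {m : ℕ} (hΦ : IsAdmissible Φ)
    {u φ : Fin m → EuclideanSpace ℝ (Fin n) → ℝ}
    (hu : ∀ i, ContDiff ℝ 1 (u i)) {a : Fin m → Fin m → EuclideanSpace ℝ (Fin n) → ℝ}
    (ha : ∀ i j, Continuous (a i j)) (hsymm : ∀ i j x, a i j x = a j i x)
    (hφ : ∀ i, ContDiff ℝ 1 (φ i)) (hφ0 : ∀ i x, φ i x ≠ 0)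
    (hpos : ∀ i j, i ≠ j → ∀ x, 0 < a i j x * φ j x * φ i x)
    (hφa : ∀ i, NegDivEqWeakly (fun x => applyA Φ (gradient (u i) x) (gradient (φ i) x))
      (fun x => ∑ j, a i j x * φ j x))
    {ζ : Fin m → EuclideanSpace ℝ (Fin n) → ℝ} (hζ : ∀ i, ContDiff ℝ 1 (ζ i))
    (hc : ∀ i, HasCompactSupport (ζ i)) (hs : ∀ i, ∀ x ∈ tsupport (ζ i), gradient (u i) x ≠ 0) :
    ∫ x, ∑ i, ∑ j, (if i = j then a i j x * ζ i x ^ 2 else |a i j x| * |ζ i x| * |ζ j x|) ≤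
      ∑ i, ∫ x, inner ℝ (coeffA Φ (gradient (u i) x) (gradient (ζ i) x)) (gradient (ζ i) x) := by
  have hcψ : ∀ i, HasCompactSupport fun x => ζ i x ^ 2 / φ i x := fun i => by
    refine (hc i).mono fun x hx h => hx ?_
    simp [h]
  have hint : ∀ i, Integrable fun x => (∑ j, a i j x * φ j x) * (ζ i x ^ 2 / φ i x) := fun i => by
    refine Continuous.integrable_of_hasCompactSupport (.mul ?_ ?_) (hcψ i).mul_left
    · exact continuous_finsetSum _ fun j _ => (ha i j).mul (hφ j).continuous
    · exact ((hζ i).continuous.pow 2).div (hφ i).continuous (hφ0 i)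
  refine le_trans ?_ (Finset.sum_le_sum fun i _ =>
    integral_mul_sq_div_le hΦ (hu i) (hφ i) (hφ0 i) (hφa i) (hζ i) (hc i) (hs i))
  rw [← integral_finsetSum _ fun i _ => hint i]
  refine integral_mono_ae ?_ (integrable_finsetSum _ fun i _ => hint i)
    (Eventually.of_forall fun x => ?_)
  · refine integrable_finsetSum _ fun i _ => integrable_finsetSum _ fun j _ => ?_
    split_ifs
    · refine ((ha i j).mul ((hζ i).continuous.pow 2)).integrable_of_hasCompactSupport ?_
      refine (hc i).mono fun x hx h => hx ?_
      simp [h]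
    · refine (((ha i j).abs.mul (hζ i).continuous.abs).mul
        (hζ j).continuous.abs).integrable_of_hasCompactSupport ?_
      refine (hc i).mono fun x hx h => hx ?_
      simp [h]
  · dsimp only
    -- The double sum is symmetrized by pairing `(i, j)` with `(j, i)`, whence the factor `2`.
    -- Diagonal pairs give equality; the others use `a i j = a j i`.
    have hT : ∀ i j, 2 * (if i = j then a i j x * ζ i x ^ 2 else |a i j x| * |ζ i x| * |ζ j x|) ≤
        a i j x * φ j x * (ζ i x ^ 2 / φ i x) + a j i x * φ i x * (ζ j x ^ 2 / φ j x) := by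
      intro i j
      split_ifs with h
      · subst h
        have := hφ0 i x
        have e : a i i x * φ i x * (ζ i x ^ 2 / φ i x) = a i i x * ζ i x ^ 2 := by field_simp
        rw [e]; linarith
      · rw [hsymm j i]
        exact two_mul_abs_le_of_pos (hφ0 j x) (hφ0 i x) (hpos i j h x)
    have h1 := Finset.sum_le_sum fun i (_ : i ∈ Finset.univ) =>
      Finset.sum_le_sum fun j (_ : j ∈ Finset.univ) => hT i j
    simp only [Finset.sum_add_distrib, ← Finset.mul_sum] at h1
    rw [Finset.sum_comm (f := fun i j => a j i x * φ i x * (ζ j x ^ 2 / φ j x))] at h1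
    simp only [Finset.sum_mul]
    linarith

end stability

/-! ### Normal and tangential energies in the plane. -/

section planar

/-- The Euclidean plane. -/
abbrev Plane : Type := EuclideanSpace ℝ (Fin 2)

/-- Rotation by a right angle. -/
noncomputable def rot (v : Plane) : Plane := !₂[-v 1, v 0]

theorem continuous_rot : Continuous rot := by
  unfold rot
  fun_prop

theorem norm_rot (v : Plane) : ‖rot v‖ = ‖v‖ := by
  simp [rot, EuclideanSpace.norm_eq, Fin.sum_univ_two, add_comm]

theorem inner_rot_self (v : Plane) : inner ℝ (rot v) v = 0 := by
  rw [inner_eq_sum_mul]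
  simp [rot, Fin.sum_univ_two]
  ring

/-- `𝒜(∇f)∇|∇f| · ∇|∇f|`, where `∇f ≠ 0`. -/
noncomputable def normalEnergy (Φ : ℝ → ℝ) (f : Plane → ℝ) (x : Plane) : ℝ :=
  inner ℝ (fderiv ℝ (flux Φ f) x (gradient f x)) (fderiv ℝ (gradient f) x (gradient f x)) /
    ‖gradient f x‖ ^ 2

/-- `𝒜(∇f)∂ₜ∇f · ∂ₜ∇f`, where `∇f ≠ 0` and `t` is the unit tangent of the level curve. -/
noncomputable def tangentialEnergy (Φ : ℝ → ℝ) (f : Plane → ℝ) (x : Plane) : ℝ :=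
  inner ℝ (fderiv ℝ (flux Φ f) x (rot (gradient f x)))
    (fderiv ℝ (gradient f) x (rot (gradient f x))) / ‖gradient f x‖ ^ 2

variable {Φ : ℝ → ℝ} {f : Plane → ℝ}

/-- The Hessian energy is a trace, so it may be computed in the orthonormal basis formed by `∇f /
|∇f|` and its rotation. -/
theorem hessianEnergy_eq {x : Plane} (hx : gradient f x ≠ 0) :
    hessianEnergy Φ f x = normalEnergy Φ f x + tangentialEnergy Φ f x := by
  have hn : ‖gradient f x‖ ^ 2 ≠ 0 := by positivity
  unfold hessianEnergy normalEnergy tangentialEnergy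
  rw [← add_div, eq_div_iff hn]
  set v := gradient f x
  have h1 : v = v 0 • EuclideanSpace.single 0 (1 : ℝ) + v 1 • EuclideanSpace.single 1 (1 : ℝ) := by
    conv_lhs => rw [← sum_smul_single v, Fin.sum_univ_two]
  have h2 : rot v =
      (-v 1) • EuclideanSpace.single 0 (1 : ℝ) + v 0 • EuclideanSpace.single 1 (1 : ℝ) := by
    conv_lhs => rw [← sum_smul_single (rot v), Fin.sum_univ_two]
    simp [rot]
  have h3 : ‖v‖ ^ 2 = v 0 ^ 2 + v 1 ^ 2 := by
    rw [← real_inner_self_eq_norm_sq, inner_eq_sum_mul, Fin.sum_univ_two]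
    ring
  generalize hL : fderiv ℝ (flux Φ f) x = L
  generalize hN : fderiv ℝ (gradient f) x = N
  rw [h2, h3]
  have h4 : ∀ T : Plane →L[ℝ] Plane, T v = v 0 • T (EuclideanSpace.single 0 (1 : ℝ)) +
      v 1 • T (EuclideanSpace.single 1 (1 : ℝ)) := fun T => by
    conv_lhs => rw [h1]
    rw [map_add, map_smul, map_smul]
  rw [h4 L, h4 N]
  simp only [Fin.sum_univ_two, map_add, map_smul, inner_add_left, inner_add_right,
    inner_smul_left, inner_smul_right, RCLike.conj_to_real]
  ring

theorem normalEnergy_nonneg (hΦ : IsAdmissible Φ) (hf : ContDiff ℝ 1 f)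
    (hX : ContDiff ℝ 1 (flux Φ f)) (x : Plane) : 0 ≤ normalEnergy Φ f x := by
  unfold normalEnergy
  rcases eq_or_ne (gradient f x) 0 with h | h
  · simp [h]
  · rw [fderiv_flux hΦ hf hX h]
    exact div_nonneg (inner_coeffA_self_nonneg hΦ h _) (by positivity)

theorem tangentialEnergy_nonneg (hΦ : IsAdmissible Φ) (hf : ContDiff ℝ 1 f)
    (hX : ContDiff ℝ 1 (flux Φ f)) (x : Plane) : 0 ≤ tangentialEnergy Φ f x := by
  unfold tangentialEnergy
  rcases eq_or_ne (gradient f x) 0 with h | h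
  · simp [h]
  · rw [fderiv_flux hΦ hf hX h]
    exact div_nonneg (inner_coeffA_self_nonneg hΦ h _) (by positivity)

theorem continuousAt_normalEnergy (hΦ : IsAdmissible Φ) (hf : ContDiff ℝ 1 f)
    (hX : ContDiff ℝ 1 (flux Φ f)) {x : Plane} (hx : gradient f x ≠ 0) :
    ContinuousAt (normalEnergy Φ f) x := by
  have hG := (continuous_gradient hf).continuousAt (x := x)
  have hX' := (hX.continuous_fderiv (by norm_num)).continuousAt (x := x)
  have hM := continuousAt_fderiv_gradient hΦ hf hX hx
  exact ((hX'.clm_apply hG).inner (hM.clm_apply hG)).div (hG.norm.pow 2) (by positivity)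

theorem continuousAt_tangentialEnergy (hΦ : IsAdmissible Φ) (hf : ContDiff ℝ 1 f)
    (hX : ContDiff ℝ 1 (flux Φ f)) {x : Plane} (hx : gradient f x ≠ 0) :
    ContinuousAt (tangentialEnergy Φ f) x := by
  have hG := (continuous_gradient hf).continuousAt (x := x)
  have hJ : ContinuousAt (fun y => rot (gradient f y)) x :=
    (continuous_rot.comp (continuous_gradient hf)).continuousAt
  have hX' := (hX.continuous_fderiv (by norm_num)).continuousAt (x := x)
  have hM := continuousAt_fderiv_gradient hΦ hf hX hx
  exact ((hX'.clm_apply hJ).inner (hM.clm_apply hJ)).div (hG.norm.pow 2) (by positivity)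

theorem integrable_mul_sq_of_tsupport {a τ : Plane → ℝ} (hτ : Continuous τ)
    (hc : HasCompactSupport τ) (ha : ∀ x ∈ tsupport τ, ContinuousAt a x) :
    Integrable fun x => a x * τ x ^ 2 := by
  refine integrable_of_forall_mem_tsupport hc (fun x hx => ?_) fun x hx =>
    (ha x hx).mul (hτ.continuousAt.pow 2)
  rw [image_eq_zero_of_notMem_tsupport hx]
  ring

theorem contDiff_norm_gradient_mul (hΦ : IsAdmissible Φ) (hf : ContDiff ℝ 1 f)
    (hX : ContDiff ℝ 1 (flux Φ f)) {τ : Plane → ℝ} (hτ : ContDiff ℝ 1 τ)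
    (hs : ∀ x ∈ tsupport τ, gradient f x ≠ 0) : ContDiff ℝ 1 fun x => ‖gradient f x‖ * τ x :=
  contDiff_mul_of_tsupport hτ fun x hx => contDiffAt_norm_gradient hΦ hf hX (hs x hx)

/-- Product rule with `∇|∇f| = D²f ∇f / |∇f|`. The cross term is the one in
`integral_hessianEnergy_mul_sq`, which allows the cancellation in the next lemma. -/
theorem inner_coeffA_gradient_norm_mul (hΦ : IsAdmissible Φ) (hf : ContDiff ℝ 1 f)
    (hX : ContDiff ℝ 1 (flux Φ f)) {τ : Plane → ℝ} (hτ : ContDiff ℝ 1 τ) {x : Plane}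
    (hx : gradient f x ≠ 0) :
    inner ℝ (coeffA Φ (gradient f x) (gradient (fun y => ‖gradient f y‖ * τ y) x))
        (gradient (fun y => ‖gradient f y‖ * τ y) x) =
      normalEnergy Φ f x * τ x ^ 2 +
        2 * τ x * fderiv ℝ τ x (fderiv ℝ (flux Φ f) x (gradient f x)) +
        ‖gradient f x‖ ^ 2 * inner ℝ (coeffA Φ (gradient f x) (gradient τ x)) (gradient τ x) := by
  have hd : DifferentiableAt ℝ (gradient f) x :=
    (contDiffAt_gradient hΦ hf hX hx).differentiableAt (by norm_num)
  have hw : DifferentiableAt ℝ (fun y => ‖gradient f y‖) x := hd.norm ℝ hx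
  have hn : ‖gradient f x‖ ≠ 0 := norm_ne_zero_iff.2 hx
  have hgrad : gradient (fun y => ‖gradient f y‖ * τ y) x =
      (τ x * ‖gradient f x‖⁻¹) • fderiv ℝ (gradient f) x (gradient f x) +
        ‖gradient f x‖ • gradient τ x := by
    refine ext_inner_right ℝ fun v => ?_
    rw [inner_gradient_left, fderiv_fun_mul hw (hτ.differentiable (by norm_num) x), mul_smul,
      ← gradient_norm_gradient hf hx hd, inner_add_left, inner_smul_left, inner_smul_left,
      inner_gradient_left, inner_gradient_left]
    simp
    ring
  rw [hgrad, normalEnergy, fderiv_flux hΦ hf hX hx, ← inner_gradient_left,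
    real_inner_comm _ (gradient τ x)]
  simp only [map_add, map_smul, inner_add_left, inner_add_right,
    inner_smul_left, inner_smul_right, RCLike.conj_to_real]
  rw [inner_coeffA_comm _ (gradient τ x) (fderiv ℝ (gradient f) x (gradient f x))]
  field_simp
  ring

/-- Subtracting the energy identity removes the normal energy and the cross term, leaving the
tangential energy with a favourable sign. -/
theorem integral_inner_coeffA_gradient_norm_mul (hΦ : IsAdmissible Φ) (hf : ContDiff ℝ 1 f)
    (hX : ContDiff ℝ 1 (flux Φ f)) {g : Plane → ℝ} (hg : ContDiff ℝ 1 g)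
    (hfg : ∀ x, -divergence (flux Φ f) x = g x) {τ : Plane → ℝ}
    (hτ : ContDiff ℝ 1 τ) (hc : HasCompactSupport τ) (hs : ∀ x ∈ tsupport τ, gradient f x ≠ 0) :
    ∫ x, inner ℝ (coeffA Φ (gradient f x) (gradient (fun y => ‖gradient f y‖ * τ y) x))
        (gradient (fun y => ‖gradient f y‖ * τ y) x) =
      (∫ x, fderiv ℝ g x (gradient f x) * τ x ^ 2) - (∫ x, tangentialEnergy Φ f x * τ x ^ 2) +
        ∫ x, ‖gradient f x‖ ^ 2 *
          inner ℝ (coeffA Φ (gradient f x) (gradient τ x)) (gradient τ x) := by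
  have hcont : Continuous fun x => fderiv ℝ τ x (fderiv ℝ (flux Φ f) x (gradient f x)) :=
    (hτ.continuous_fderiv (by norm_num)).clm_apply
      ((hX.continuous_fderiv (by norm_num)).clm_apply (continuous_gradient hf))
  have i1 : Integrable fun x => hessianEnergy Φ f x * τ x ^ 2 +
      2 * τ x * fderiv ℝ τ x (fderiv ℝ (flux Φ f) x (gradient f x)) := by
    refine (integrable_mul_sq_of_tsupport hτ.continuous hc fun x hx =>
      continuousAt_hessianEnergy hΦ hf hX (hs x hx)).add ?_
    exact ((continuous_const.mul hτ.continuous).mul hcont).integrable_of_hasCompactSupport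
      (hc.mul_left.mul_right)
  have i2 : Integrable fun x => tangentialEnergy Φ f x * τ x ^ 2 :=
    integrable_mul_sq_of_tsupport hτ.continuous hc fun x hx =>
      continuousAt_tangentialEnergy hΦ hf hX (hs x hx)
  have i3 : Integrable fun x => ‖gradient f x‖ ^ 2 *
      inner ℝ (coeffA Φ (gradient f x) (gradient τ x)) (gradient τ x) := by
    refine integrable_of_forall_mem_tsupport hc (fun x hx => ?_) fun x hx => ?_
    · rw [gradient_eq_zero_of_notMem_tsupport hx, inner_zero_right, mul_zero]
    · have h := (continuous_gradient hτ).continuousAt (x := x)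
      exact ((continuous_gradient hf).continuousAt.norm.pow 2).mul
        (((continuousAt_coeffA_gradient hΦ hf (hs x hx)).clm_apply h).inner h)
  have i4 : Integrable fun x => hessianEnergy Φ f x * τ x ^ 2 +
      2 * τ x * fderiv ℝ τ x (fderiv ℝ (flux Φ f) x (gradient f x)) -
        tangentialEnergy Φ f x * τ x ^ 2 := i1.sub i2
  rw [← integral_hessianEnergy_mul_sq hΦ hf hX hg hfg hτ hc hs, ← integral_sub i1 i2,
    ← integral_add i4 i3]
  refine integral_congr_ae (Eventually.of_forall fun x => ?_)
  dsimp only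
  by_cases hx : x ∈ tsupport τ
  · rw [inner_coeffA_gradient_norm_mul hΦ hf hX hτ (hs x hx), hessianEnergy_eq (hs x hx)]
    ring
  · have h1 : τ x = 0 := image_eq_zero_of_notMem_tsupport hx
    have h2 : x ∉ tsupport fun y => ‖gradient f y‖ * τ y := fun h =>
      hx (closure_mono (Function.support_mul_subset_right _ _) h)
    simp [h1, gradient_eq_zero_of_notMem_tsupport hx, gradient_eq_zero_of_notMem_tsupport h2]

end planar

/-! ### Cutting off a neighbourhood of the critical set. -/

section truncation

/-- Fatou's lemma. It turns uniform bounds on truncated energies into integrability of the full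
ones. -/
theorem integrable_of_tendsto_of_integral_le {α : Type*} [MeasurableSpace α] {μ : Measure α}
    {F : ℕ → α → ℝ} {f : α → ℝ} {C : ℝ} (hF : ∀ k, Integrable (F k) μ) (h0 : ∀ k x, 0 ≤ F k x)
    (hC : ∀ k, ∫ x, F k x ∂μ ≤ C) (hlim : ∀ x, Tendsto (fun k => F k x) atTop (𝓝 (f x))) :
    Integrable f μ := by
  refine ⟨aestronglyMeasurable_of_tendsto_ae _ (fun k => (hF k).aestronglyMeasurable)
    (Eventually.of_forall hlim), ?_⟩
  calc ∫⁻ x, ‖f x‖ₑ ∂μ = ∫⁻ x, liminf (fun k => ‖F k x‖ₑ) atTop ∂μ :=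
        lintegral_congr fun x => (hlim x).enorm.liminf_eq.symm
    _ ≤ liminf (fun k => ∫⁻ x, ‖F k x‖ₑ ∂μ) atTop :=
        lintegral_liminf_le' fun k => (hF k).aestronglyMeasurable.aemeasurable.enorm
    _ ≤ ENNReal.ofReal C := by
        refine liminf_le_of_le (by isBoundedDefault) fun b hb => ?_
        obtain ⟨k, hk⟩ := hb.exists
        refine hk.trans ?_
        rw [← ofReal_integral_norm_eq_lintegral_enorm (hF k)]
        refine ENNReal.ofReal_le_ofReal ?_
        simpa only [Real.norm_of_nonneg (h0 k _)] using hC k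
    _ < ⊤ := ENNReal.ofReal_lt_top

/-- A smooth step from `0` on `(-∞, 1]` to `1` on `[2, ∞)`. -/
noncomputable def step (t : ℝ) : ℝ := Real.smoothTransition (t - 1)

theorem contDiff_step : ContDiff ℝ 1 step :=
  Real.smoothTransition.contDiff.comp (contDiff_id.sub contDiff_const)

theorem step_of_le {t : ℝ} (h : t ≤ 1) : step t = 0 :=
  Real.smoothTransition.zero_of_nonpos (by linarith)

theorem step_of_ge {t : ℝ} (h : 2 ≤ t) : step t = 1 :=
  Real.smoothTransition.one_of_one_le (by linarith)

theorem step_nonneg (t : ℝ) : 0 ≤ step t := Real.smoothTransition.nonneg _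

theorem step_le_one (t : ℝ) : step t ≤ 1 := Real.smoothTransition.le_one _

theorem deriv_step_nonneg (t : ℝ) : 0 ≤ deriv step t :=
  Monotone.deriv_nonneg fun _ _ h => Real.smoothTransition.monotone (sub_le_sub_right h 1)

theorem deriv_step_of_gt {t : ℝ} (h : 2 < t) : deriv step t = 0 := by
  have : step =ᶠ[𝓝 t] fun _ => 1 := by
    filter_upwards [Ioi_mem_nhds h] with s hs using step_of_ge (le_of_lt hs)
  rw [this.deriv_eq, deriv_const]

theorem deriv_step_of_lt {t : ℝ} (h : t < 1) : deriv step t = 0 := by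
  have : step =ᶠ[𝓝 t] fun _ => 0 := by
    filter_upwards [Iio_mem_nhds h] with s hs using step_of_le (le_of_lt hs)
  rw [this.deriv_eq, deriv_const]

/-- Used with `t = (k + 1) |∇f|`: the weight `|∇f|` absorbs the factor `k + 1` from differentiating
the truncation, uniformly in `k`. -/
theorem exists_sq_mul_deriv_step_le : ∃ C, ∀ t, (t * deriv step t) ^ 2 ≤ C := by
  have hcont : Continuous fun t => (t * deriv step t) ^ 2 :=
    (continuous_id.mul (contDiff_step.continuous_deriv le_rfl)).pow 2
  have hc : HasCompactSupport fun t => (t * deriv step t) ^ 2 := by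
    refine HasCompactSupport.intro (isCompact_Icc (a := (1 : ℝ)) (b := 2)) fun t ht => ?_
    rcases lt_or_ge t 1 with h | h
    · simp [deriv_step_of_lt h]
    · have h2 : 2 < t := not_le.1 fun h2 => ht ⟨h, h2⟩
      simp [deriv_step_of_gt h2]
  obtain ⟨C, hC⟩ := hcont.bounded_above_of_compact_support hc
  exact ⟨C, fun t => (le_abs_self _).trans (hC t)⟩

/-- A cutoff of `η` to the region where `|∇f|` is not small. -/
noncomputable def truncation (f η : Plane → ℝ) (k : ℕ) (x : Plane) : ℝ :=
  step ((k + 1) * ‖gradient f x‖) * η x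

variable {Φ : ℝ → ℝ} {f η : Plane → ℝ}

theorem gradient_ne_zero_of_mem_tsupport_truncation (hf : ContDiff ℝ 1 f) {k : ℕ} {x : Plane}
    (hx : x ∈ tsupport (truncation f η k)) : gradient f x ≠ 0 := by
  have hsub : tsupport (truncation f η k) ⊆ {y | 1 ≤ ((k : ℝ) + 1) * ‖gradient f y‖} := by
    refine closure_minimal (fun y hy => ?_)
      (isClosed_le continuous_const (continuous_const.mul (continuous_gradient hf).norm))
    by_contra h
    exact hy (by simp [truncation, step_of_le (not_le.1 h).le])
  intro h0
  have := hsub hx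
  simp only [mem_ofPred_eq, h0, norm_zero, mul_zero] at this
  linarith

/-- The truncation vanishes in a neighbourhood of every critical point, and elsewhere `|∇f|` is
`C¹`. -/
theorem contDiff_truncation (hΦ : IsAdmissible Φ) (hf : ContDiff ℝ 1 f)
    (hX : ContDiff ℝ 1 (flux Φ f)) (hη : ContDiff ℝ 1 η) (k : ℕ) :
    ContDiff ℝ 1 (truncation f η k) := by
  refine contDiff_iff_contDiffAt.2 fun x => ?_
  by_cases hx : gradient f x = 0
  · refine contDiffAt_const (c := (0 : ℝ)) |>.congr_of_eventuallyEq ?_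
    exact notMem_tsupport_iff_eventuallyEq.1 fun h =>
      gradient_ne_zero_of_mem_tsupport_truncation hf h hx
  · exact (contDiff_step.contDiffAt.comp x
      (contDiffAt_const.mul (contDiffAt_norm_gradient hΦ hf hX hx))).mul hη.contDiffAt

theorem hasCompactSupport_truncation (hc : HasCompactSupport η) (k : ℕ) :
    HasCompactSupport (truncation f η k) := hc.mul_left

theorem truncation_sq_le (k : ℕ) (x : Plane) : truncation f η k x ^ 2 ≤ η x ^ 2 := by
  rw [truncation, mul_pow]
  exact mul_le_of_le_one_left (sq_nonneg _) (pow_le_one₀ (step_nonneg _) (step_le_one _))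

theorem eventually_lt_succ_mul {w : ℝ} (hw : 0 < w) :
    ∀ᶠ k : ℕ in atTop, 2 < ((k : ℝ) + 1) * w := by
  have h : Tendsto (fun k : ℕ => ((k : ℝ) + 1) * w) atTop atTop :=
    (tendsto_atTop_add_const_right _ 1 tendsto_natCast_atTop_atTop).atTop_mul_const hw
  exact h.eventually_gt_atTop 2

theorem eventually_truncation_eq {x : Plane} (hx : gradient f x ≠ 0) :
    ∀ᶠ k in atTop, truncation f η k x = η x := by
  filter_upwards [eventually_lt_succ_mul (norm_pos_iff.2 hx)] with k hk
  rw [truncation, step_of_ge hk.le, one_mul]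

theorem tendsto_mul_truncation_sq {a : ℝ} {x : Plane} (ha : gradient f x = 0 → a = 0) :
    Tendsto (fun k => a * truncation f η k x ^ 2) atTop (𝓝 (a * η x ^ 2)) := by
  by_cases hx : gradient f x = 0
  · simp [ha hx]
  · refine tendsto_const_nhds.congr' ?_
    filter_upwards [eventually_truncation_eq (η := η) hx] with k hk
    rw [hk]

theorem fderiv_truncation (hΦ : IsAdmissible Φ) (hf : ContDiff ℝ 1 f)
    (hX : ContDiff ℝ 1 (flux Φ f)) (hη : ContDiff ℝ 1 η) (k : ℕ) {x : Plane}
    (hx : gradient f x ≠ 0) (v : Plane) :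
    fderiv ℝ (truncation f η k) x v =
      (k + 1) * deriv step ((k + 1) * ‖gradient f x‖) * ‖gradient f x‖⁻¹ * η x *
          inner ℝ (fderiv ℝ (gradient f) x (gradient f x)) v +
        step ((k + 1) * ‖gradient f x‖) * fderiv ℝ η x v := by
  have hd : DifferentiableAt ℝ (gradient f) x :=
    (contDiffAt_gradient hΦ hf hX hx).differentiableAt (by norm_num)
  have hw : DifferentiableAt ℝ (fun y => ‖gradient f y‖) x := hd.norm ℝ hx
  have h1 : HasFDerivAt (fun y => ((k : ℝ) + 1) * ‖gradient f y‖) _ x :=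
    hw.hasFDerivAt.const_mul _
  have h2 : HasDerivAt step (deriv step ((k + 1) * ‖gradient f x‖)) ((k + 1) * ‖gradient f x‖) :=
    (contDiff_step.differentiable (by norm_num) _).hasDerivAt
  have h3 := (h2.comp_hasFDerivAt x h1).mul (hη.differentiable (by norm_num) x).hasFDerivAt
  have h4 : HasFDerivAt (truncation f η k) _ x := h3
  rw [h4.fderiv]
  simp only [add_apply, smul_apply, smul_eq_mul, Function.comp_apply]
  rw [← inner_gradient_left (f := fun y => ‖gradient f y‖), gradient_norm_gradient hf hx hd,
    inner_smul_left]
  simp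
  ring

end truncation

/-! ### Uniform energy bounds and removal of the truncation. -/

section limit

variable {Φ : ℝ → ℝ} {f η g : Plane → ℝ}

theorem inner_fderiv_flux_gradient (Φ : ℝ → ℝ) (f : Plane → ℝ) {x : Plane}
    (hx : gradient f x ≠ 0) :
    inner ℝ (fderiv ℝ (gradient f) x (gradient f x)) (fderiv ℝ (flux Φ f) x (gradient f x)) =
      ‖gradient f x‖ ^ 2 * normalEnergy Φ f x := by
  have hn : ‖gradient f x‖ ≠ 0 := norm_ne_zero_iff.2 hx
  rw [normalEnergy, real_inner_comm]
  field_simp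

/-- The term in which the derivative falls on `step` is nonnegative, since `step` is nondecreasing
and the normal energy is nonnegative. Dropping it leaves a bound independent of `k`. -/
theorem neg_le_mul_fderiv_truncation (hΦ : IsAdmissible Φ) (hf : ContDiff ℝ 1 f)
    (hX : ContDiff ℝ 1 (flux Φ f)) (hη : ContDiff ℝ 1 η) (k : ℕ) {x : Plane}
    (hx : gradient f x ≠ 0) :
    -(2 * |η x| * |fderiv ℝ η x (fderiv ℝ (flux Φ f) x (gradient f x))|) ≤
      2 * truncation f η k x *
        fderiv ℝ (truncation f η k) x (fderiv ℝ (flux Φ f) x (gradient f x)) := by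
  rw [fderiv_truncation hΦ hf hX hη k hx, inner_fderiv_flux_gradient Φ f hx, truncation]
  have hB := normalEnergy_nonneg hΦ hf hX x
  set s := step ((k + 1) * ‖gradient f x‖)
  have hs0 : 0 ≤ s := step_nonneg _
  have hs1 : s ^ 2 ≤ 1 := pow_le_one₀ hs0 (step_le_one _)
  have hd := deriv_step_nonneg ((k + 1) * ‖gradient f x‖)
  set d := deriv step ((k + 1) * ‖gradient f x‖)
  set D := fderiv ℝ η x (fderiv ℝ (flux Φ f) x (gradient f x))
  have h1 : 0 ≤ 2 * s * η x ^ 2 * (((k : ℝ) + 1) * d * ‖gradient f x‖⁻¹ *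
      (‖gradient f x‖ ^ 2 * normalEnergy Φ f x)) := by positivity
  have h2 : s ^ 2 * |η x * D| ≤ |η x * D| := mul_le_of_le_one_left (abs_nonneg _) hs1
  have h3 : s ^ 2 * (-|η x * D|) ≤ s ^ 2 * (η x * D) :=
    mul_le_mul_of_nonneg_left (neg_abs_le _) (sq_nonneg s)
  rw [mul_assoc, ← abs_mul]
  linarith

/-- A Caccioppoli estimate, uniform in the truncation. -/
theorem integral_energy_mul_truncation_sq_le (hΦ : IsAdmissible Φ) (hf : ContDiff ℝ 1 f)
    (hX : ContDiff ℝ 1 (flux Φ f)) (hg : ContDiff ℝ 1 g)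
    (hfg : ∀ x, -divergence (flux Φ f) x = g x) (hη : ContDiff ℝ 1 η)
    (hc : HasCompactSupport η) :
    ∃ C, ∀ k, ∫ x, normalEnergy Φ f x * truncation f η k x ^ 2 ≤ C ∧
      ∫ x, tangentialEnergy Φ f x * truncation f η k x ^ 2 ≤ C := by
  have hcη2 : HasCompactSupport fun x => η x ^ 2 := by
    refine hc.mono fun x hx h => hx ?_
    simp [h]
  have c1 : Continuous fun x => fderiv ℝ g x (gradient f x) :=
    (hg.continuous_fderiv (by norm_num)).clm_apply (continuous_gradient hf)
  have c2 : Continuous fun x => fderiv ℝ η x (fderiv ℝ (flux Φ f) x (gradient f x)) :=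
    (hη.continuous_fderiv (by norm_num)).clm_apply
      ((hX.continuous_fderiv (by norm_num)).clm_apply (continuous_gradient hf))
  have i1 : Integrable fun x => |fderiv ℝ g x (gradient f x)| * η x ^ 2 :=
    (c1.abs.mul (hη.continuous.pow 2)).integrable_of_hasCompactSupport hcη2.mul_left
  have i2 : Integrable fun x =>
      2 * |η x| * |fderiv ℝ η x (fderiv ℝ (flux Φ f) x (gradient f x))| := by
    refine ((continuous_const.mul hη.continuous.abs).mul c2.abs).integrable_of_hasCompactSupport ?_
    refine hc.mono fun x hx h => hx ?_
    simp [h]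
  refine ⟨(∫ x, |fderiv ℝ g x (gradient f x)| * η x ^ 2) +
    ∫ x, 2 * |η x| * |fderiv ℝ η x (fderiv ℝ (flux Φ f) x (gradient f x))|, fun k => ?_⟩
  set τ := truncation f η k with hτdef
  have hτ : ContDiff ℝ 1 τ := contDiff_truncation hΦ hf hX hη k
  have hcτ : HasCompactSupport τ := hasCompactSupport_truncation hc k
  have hs : ∀ x ∈ tsupport τ, gradient f x ≠ 0 := fun x hx =>
    gradient_ne_zero_of_mem_tsupport_truncation hf hx
  have iB : Integrable fun x => normalEnergy Φ f x * τ x ^ 2 :=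
    integrable_mul_sq_of_tsupport hτ.continuous hcτ fun x hx =>
      continuousAt_normalEnergy hΦ hf hX (hs x hx)
  have iQ : Integrable fun x => tangentialEnergy Φ f x * τ x ^ 2 :=
    integrable_mul_sq_of_tsupport hτ.continuous hcτ fun x hx =>
      continuousAt_tangentialEnergy hΦ hf hX (hs x hx)
  have iP : Integrable fun x => hessianEnergy Φ f x * τ x ^ 2 +
      2 * τ x * fderiv ℝ τ x (fderiv ℝ (flux Φ f) x (gradient f x)) := by
    refine (integrable_mul_sq_of_tsupport hτ.continuous hcτ fun x hx =>
      continuousAt_hessianEnergy hΦ hf hX (hs x hx)).add ?_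
    have c3 : Continuous fun x => fderiv ℝ τ x (fderiv ℝ (flux Φ f) x (gradient f x)) :=
      (hτ.continuous_fderiv (by norm_num)).clm_apply
        ((hX.continuous_fderiv (by norm_num)).clm_apply (continuous_gradient hf))
    exact ((continuous_const.mul hτ.continuous).mul c3).integrable_of_hasCompactSupport
      (hcτ.mul_left.mul_right)
  have iD : Integrable fun x => fderiv ℝ g x (gradient f x) * τ x ^ 2 :=
    integrable_mul_sq_of_tsupport hτ.continuous hcτ fun x _ => c1.continuousAt
  -- Up to an error involving only `η`, the energies are bounded by the integrand of the energy
  -- identity, whose integral is then replaced by the right-hand side of that identity.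
  have hpt : ∫ x, (normalEnergy Φ f x * τ x ^ 2 + tangentialEnergy Φ f x * τ x ^ 2) ≤
      ∫ x, ((hessianEnergy Φ f x * τ x ^ 2 +
        2 * τ x * fderiv ℝ τ x (fderiv ℝ (flux Φ f) x (gradient f x))) +
          2 * |η x| * |fderiv ℝ η x (fderiv ℝ (flux Φ f) x (gradient f x))|) := by
    refine integral_mono_ae (iB.add iQ) (iP.add i2) (Eventually.of_forall fun x => ?_)
    dsimp only
    by_cases hx : gradient f x = 0
    · have h0 : τ x = 0 := image_eq_zero_of_notMem_tsupport fun h => hs x h hx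
      simp only [h0]
      simp only [ne_eq, OfNat.ofNat_ne_zero, not_false_eq_true, zero_pow, mul_zero, zero_mul,
        add_zero, zero_add]
      positivity
    · rw [hessianEnergy_eq hx]
      have := neg_le_mul_fderiv_truncation hΦ hf hX hη k hx
      rw [← hτdef] at this
      linarith
  rw [integral_add iB iQ, integral_add iP i2,
    integral_hessianEnergy_mul_sq hΦ hf hX hg hfg hτ hcτ hs] at hpt
  have hD : ∫ x, fderiv ℝ g x (gradient f x) * τ x ^ 2 ≤
      ∫ x, |fderiv ℝ g x (gradient f x)| * η x ^ 2 := by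
    refine integral_mono_ae iD i1 (Eventually.of_forall fun x => ?_)
    dsimp only
    exact mul_le_mul (le_abs_self _) (truncation_sq_le k x) (sq_nonneg _) (abs_nonneg _)
  have hB0 : 0 ≤ ∫ x, normalEnergy Φ f x * τ x ^ 2 :=
    integral_nonneg fun x => mul_nonneg (normalEnergy_nonneg hΦ hf hX x) (sq_nonneg _)
  have hQ0 : 0 ≤ ∫ x, tangentialEnergy Φ f x * τ x ^ 2 :=
    integral_nonneg fun x => mul_nonneg (tangentialEnergy_nonneg hΦ hf hX x) (sq_nonneg _)
  constructor <;> linarith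

theorem normalEnergy_eq_zero {x : Plane} (hx : gradient f x = 0) : normalEnergy Φ f x = 0 := by
  simp [normalEnergy, hx]

theorem tangentialEnergy_eq_zero {x : Plane} (hx : gradient f x = 0) :
    tangentialEnergy Φ f x = 0 := by
  simp [tangentialEnergy, hx]

theorem integrable_normalEnergy_mul_sq (hΦ : IsAdmissible Φ) (hf : ContDiff ℝ 1 f)
    (hX : ContDiff ℝ 1 (flux Φ f)) (hg : ContDiff ℝ 1 g)
    (hfg : ∀ x, -divergence (flux Φ f) x = g x) (hη : ContDiff ℝ 1 η)
    (hc : HasCompactSupport η) : Integrable fun x => normalEnergy Φ f x * η x ^ 2 := by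
  obtain ⟨C, hC⟩ := integral_energy_mul_truncation_sq_le hΦ hf hX hg hfg hη hc
  refine integrable_of_tendsto_of_integral_le
    (F := fun k x => normalEnergy Φ f x * truncation f η k x ^ 2) (fun k => ?_)
    (fun k x => mul_nonneg (normalEnergy_nonneg hΦ hf hX x) (sq_nonneg _)) (fun k => (hC k).1)
    fun x => tendsto_mul_truncation_sq normalEnergy_eq_zero
  exact integrable_mul_sq_of_tsupport (contDiff_truncation hΦ hf hX hη k).continuous
    (hasCompactSupport_truncation hc k) fun x hx =>
      continuousAt_normalEnergy hΦ hf hX (gradient_ne_zero_of_mem_tsupport_truncation hf hx)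

theorem integrable_tangentialEnergy_mul_sq (hΦ : IsAdmissible Φ) (hf : ContDiff ℝ 1 f)
    (hX : ContDiff ℝ 1 (flux Φ f)) (hg : ContDiff ℝ 1 g)
    (hfg : ∀ x, -divergence (flux Φ f) x = g x) (hη : ContDiff ℝ 1 η)
    (hc : HasCompactSupport η) : Integrable fun x => tangentialEnergy Φ f x * η x ^ 2 := by
  obtain ⟨C, hC⟩ := integral_energy_mul_truncation_sq_le hΦ hf hX hg hfg hη hc
  refine integrable_of_tendsto_of_integral_le
    (F := fun k x => tangentialEnergy Φ f x * truncation f η k x ^ 2) (fun k => ?_)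
    (fun k x => mul_nonneg (tangentialEnergy_nonneg hΦ hf hX x) (sq_nonneg _))
    (fun k => (hC k).2) fun x => tendsto_mul_truncation_sq tangentialEnergy_eq_zero
  exact integrable_mul_sq_of_tsupport (contDiff_truncation hΦ hf hX hη k).continuous
    (hasCompactSupport_truncation hc k) fun x hx =>
      continuousAt_tangentialEnergy hΦ hf hX (gradient_ne_zero_of_mem_tsupport_truncation hf hx)

/-- Dominated convergence with majorant `|a| η²`. The truncations vanish on the critical set for
every `k`, so the limit is right only if `a` vanishes there. -/
theorem tendsto_integral_mul_truncation_sq (hΦ : IsAdmissible Φ) (hf : ContDiff ℝ 1 f)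
    (hX : ContDiff ℝ 1 (flux Φ f)) (hη : ContDiff ℝ 1 η) {a : Plane → ℝ}
    (ha : Integrable fun x => a x * η x ^ 2) (ham : AEStronglyMeasurable a)
    (ha0 : ∀ x, gradient f x = 0 → a x = 0) :
    Tendsto (fun k => ∫ x, a x * truncation f η k x ^ 2) atTop (𝓝 (∫ x, a x * η x ^ 2)) := by
  refine tendsto_integral_of_dominated_convergence _ (fun k => ?_) ha.norm
    (fun k => Eventually.of_forall fun x => ?_)
    (Eventually.of_forall fun x => tendsto_mul_truncation_sq (ha0 x))
  · exact ham.mul ((contDiff_truncation hΦ hf hX hη k).continuous.pow 2).aestronglyMeasurable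
  · rw [norm_mul, norm_mul]
    refine mul_le_mul_of_nonneg_left ?_ (norm_nonneg _)
    rw [Real.norm_of_nonneg (sq_nonneg _), Real.norm_of_nonneg (sq_nonneg _)]
    exact truncation_sq_le k x

theorem aestronglyMeasurable_of_continuousAt (hf : ContDiff ℝ 1 f) {a : Plane → ℝ}
    (ha : ∀ x, gradient f x ≠ 0 → ContinuousAt a x) (ha0 : ∀ x, gradient f x = 0 → a x = 0) :
    AEStronglyMeasurable a := by
  have hopen : IsOpen {x | gradient f x ≠ 0} :=
    isOpen_ne_fun (continuous_gradient hf) continuous_const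
  have h1 : AEStronglyMeasurable a (volume.restrict {x | gradient f x ≠ 0}) :=
    ContinuousOn.aestronglyMeasurable (fun x hx => (ha x hx).continuousWithinAt)
      hopen.measurableSet
  have h2 := (aestronglyMeasurable_indicator_iff hopen.measurableSet).2 h1
  refine h2.congr (Eventually.of_forall fun x => ?_)
  by_cases hx : gradient f x = 0
  · rw [indicator_of_notMem (by simpa using hx), ha0 x hx]
  · rw [indicator_of_mem (by exact hx)]

/-- `∇τ` is the sum of a multiple of `D²f ∇f` and a multiple of `∇η`. The former yields the normal
energy, the latter is controlled by the weighted bound on `𝒜`. -/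
theorem sq_norm_mul_inner_coeffA_truncation_le (hΦ : IsAdmissible Φ) (hf : ContDiff ℝ 1 f)
    (hX : ContDiff ℝ 1 (flux Φ f)) (hη : ContDiff ℝ 1 η) {C : ℝ} (hC0 : 0 ≤ C) {x : Plane}
    (hC : gradient f x ≠ 0 → ∀ ξ, ‖gradient f x‖ ^ 2 * inner ℝ (coeffA Φ (gradient f x) ξ) ξ ≤
      C * ‖ξ‖ ^ 2) (k : ℕ) :
    ‖gradient f x‖ ^ 2 * inner ℝ (coeffA Φ (gradient f x) (gradient (truncation f η k) x))
        (gradient (truncation f η k) x) ≤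
      2 * (((k + 1) * ‖gradient f x‖) * deriv step ((k + 1) * ‖gradient f x‖)) ^ 2 *
        (normalEnergy Φ f x * η x ^ 2) + 2 * C * ‖gradient η x‖ ^ 2 := by
  by_cases hx : gradient f x = 0
  · simp only [hx, norm_zero, mul_zero, zero_mul, ne_eq, OfNat.ofNat_ne_zero, not_false_eq_true,
      zero_pow, zero_add]
    positivity
  have hn : ‖gradient f x‖ ≠ 0 := norm_ne_zero_iff.2 hx
  have hgrad : gradient (truncation f η k) x =
      ((k + 1) * deriv step ((k + 1) * ‖gradient f x‖) * ‖gradient f x‖⁻¹ * η x) •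
          fderiv ℝ (gradient f) x (gradient f x) +
        step ((k + 1) * ‖gradient f x‖) • gradient η x := by
    refine ext_inner_right ℝ fun v => ?_
    rw [inner_gradient_left, fderiv_truncation hΦ hf hX hη k hx, inner_add_left, inner_smul_left,
      inner_smul_left, inner_gradient_left]
    simp
  have hB := inner_fderiv_flux_gradient Φ f hx
  rw [fderiv_flux hΦ hf hX hx, real_inner_comm] at hB
  -- Nonnegativity on the difference `v - w` gives `𝒜(v + w) · (v + w) ≤ 2 𝒜v · v + 2 𝒜w · w`.
  have hpos := inner_coeffA_self_nonneg hΦ hx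
    (((k + 1) * deriv step ((k + 1) * ‖gradient f x‖) * ‖gradient f x‖⁻¹ * η x) •
          fderiv ℝ (gradient f) x (gradient f x) -
        step ((k + 1) * ‖gradient f x‖) • gradient η x)
  have hη' := hC hx (gradient η x)
  rw [hgrad]
  set s := step ((k + 1) * ‖gradient f x‖)
  have hs1 : s ^ 2 ≤ 1 := pow_le_one₀ (step_nonneg _) (step_le_one _)
  have hs2 : s ^ 2 * (‖gradient f x‖ ^ 2 *
      inner ℝ (coeffA Φ (gradient f x) (gradient η x)) (gradient η x)) ≤
      C * ‖gradient η x‖ ^ 2 :=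
    (mul_le_mul_of_nonneg_left hη' (sq_nonneg s)).trans
      (mul_le_of_le_one_left (by positivity) hs1)
  set d := deriv step ((k + 1) * ‖gradient f x‖)
  simp only [map_add, map_sub, map_smul, inner_add_left, inner_add_right, inner_sub_left,
    inner_sub_right, inner_smul_left, inner_smul_right, RCLike.conj_to_real, hB] at hpos ⊢
  have hpos' := mul_nonneg (sq_nonneg ‖gradient f x‖) hpos
  have e : ‖gradient f x‖ ^ 2 * (((k + 1) * d * ‖gradient f x‖⁻¹ * η x) *
      (((k + 1) * d * ‖gradient f x‖⁻¹ * η x) * (‖gradient f x‖ ^ 2 * normalEnergy Φ f x))) =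
      (((k + 1) * ‖gradient f x‖) * d) ^ 2 * (normalEnergy Φ f x * η x ^ 2) := by
    field_simp
  linarith

/-- The error that the truncation contributes. -/
noncomputable def truncationError (Φ : ℝ → ℝ) (f η : Plane → ℝ) (k : ℕ) (x : Plane) : ℝ :=
  2 * (((k + 1) * ‖gradient f x‖) * deriv step ((k + 1) * ‖gradient f x‖)) ^ 2 *
    (normalEnergy Φ f x * η x ^ 2)

theorem exists_norm_truncationError_le (Φ : ℝ → ℝ) (f η : Plane → ℝ) :
    ∃ C, ∀ k x, ‖truncationError Φ f η k x‖ ≤ 2 * C * ‖normalEnergy Φ f x * η x ^ 2‖ := by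
  obtain ⟨C, hC⟩ := exists_sq_mul_deriv_step_le
  refine ⟨C, fun k x => ?_⟩
  rw [truncationError, norm_mul]
  refine mul_le_mul_of_nonneg_right ?_ (norm_nonneg _)
  rw [Real.norm_of_nonneg (by positivity)]
  exact mul_le_mul_of_nonneg_left (hC _) (by norm_num)

theorem integrable_truncationError (hf : ContDiff ℝ 1 f)
    (hB : Integrable fun x => normalEnergy Φ f x * η x ^ 2) (k : ℕ) :
    Integrable (truncationError Φ f η k) := by
  obtain ⟨C, hC⟩ := exists_norm_truncationError_le Φ f η
  refine (hB.norm.const_mul (2 * C)).mono' ?_ (Eventually.of_forall fun x => hC k x)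
  have hw : Continuous fun x => ((k : ℝ) + 1) * ‖gradient f x‖ :=
    continuous_const.mul (continuous_gradient hf).norm
  have hcont : Continuous fun x =>
      2 * (((k + 1) * ‖gradient f x‖) * deriv step ((k + 1) * ‖gradient f x‖)) ^ 2 :=
    continuous_const.mul
      ((hw.mul ((contDiff_step.continuous_deriv le_rfl).comp hw)).pow 2)
  exact hcont.aestronglyMeasurable.mul hB.aestronglyMeasurable

/-- At each noncritical point the error is zero once `(k + 1) |∇f| > 2`, and at critical points the
normal energy is zero. The integrable normal energy dominates. -/
theorem tendsto_integral_truncationError (hf : ContDiff ℝ 1 f)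
    (hB : Integrable fun x => normalEnergy Φ f x * η x ^ 2) :
    Tendsto (fun k => ∫ x, truncationError Φ f η k x) atTop (𝓝 0) := by
  obtain ⟨C, hC⟩ := exists_norm_truncationError_le Φ f η
  have h := tendsto_integral_of_dominated_convergence (F := truncationError Φ f η)
    (f := fun _ => (0 : ℝ)) _ (fun k => (integrable_truncationError hf hB k).aestronglyMeasurable)
    (hB.norm.const_mul (2 * C)) (fun k => Eventually.of_forall fun x => hC k x)
    (Eventually.of_forall fun x => ?_)
  · simpa using h
  · by_cases hx : gradient f x = 0
    · simp [truncationError, normalEnergy_eq_zero hx]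
    · refine tendsto_const_nhds.congr' ?_
      filter_upwards [eventually_lt_succ_mul (norm_pos_iff.2 hx)] with k hk
      simp [truncationError, deriv_step_of_gt hk]

theorem integrable_norm_gradient_sq (hη : ContDiff ℝ 1 η) (hc : HasCompactSupport η) :
    Integrable fun x => ‖gradient η x‖ ^ 2 := by
  refine ((continuous_gradient hη).norm.pow 2).integrable_of_hasCompactSupport ?_
  refine (hasCompactSupport_gradient hc).mono fun x hx h => hx ?_
  simp [h]

theorem integral_inner_coeffA_truncation_le (hΦ : IsAdmissible Φ) (hf : ContDiff ℝ 1 f)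
    (hX : ContDiff ℝ 1 (flux Φ f)) (hg : ContDiff ℝ 1 g)
    (hfg : ∀ x, -divergence (flux Φ f) x = g x) (hη : ContDiff ℝ 1 η)
    (hc : HasCompactSupport η) {C : ℝ} (hC0 : 0 ≤ C)
    (hC : ∀ x, gradient f x ≠ 0 → ∀ ξ, ‖gradient f x‖ ^ 2 *
      inner ℝ (coeffA Φ (gradient f x) ξ) ξ ≤ C * ‖ξ‖ ^ 2) (k : ℕ) :
    ∫ x, inner ℝ
        (coeffA Φ (gradient f x) (gradient (fun y => ‖gradient f y‖ * truncation f η k y) x))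
        (gradient (fun y => ‖gradient f y‖ * truncation f η k y) x) ≤
      (∫ x, fderiv ℝ g x (gradient f x) * truncation f η k x ^ 2) -
        (∫ x, tangentialEnergy Φ f x * truncation f η k x ^ 2) +
        ((∫ x, truncationError Φ f η k x) + 2 * C * ∫ x, ‖gradient η x‖ ^ 2) := by
  have hτ := contDiff_truncation hΦ hf hX hη k
  have hcτ := hasCompactSupport_truncation (f := f) hc k
  have hs : ∀ x ∈ tsupport (truncation f η k), gradient f x ≠ 0 := fun x hx =>
    gradient_ne_zero_of_mem_tsupport_truncation hf hx
  have hB := integrable_normalEnergy_mul_sq hΦ hf hX hg hfg hη hc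
  rw [integral_inner_coeffA_gradient_norm_mul hΦ hf hX hg hfg hτ hcτ hs]
  refine add_le_add le_rfl ?_
  have iT := integrable_truncationError hf hB k
  have iη := (integrable_norm_gradient_sq hη hc).const_mul (2 * C)
  rw [← integral_const_mul, ← integral_add iT iη]
  refine integral_mono_ae ?_ (iT.add iη) (Eventually.of_forall fun x =>
    sq_norm_mul_inner_coeffA_truncation_le hΦ hf hX hη hC0 (hC x) k)
  refine integrable_of_forall_mem_tsupport hcτ (fun x hx => ?_) fun x hx => ?_
  · rw [gradient_eq_zero_of_notMem_tsupport hx, inner_zero_right, mul_zero]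
  · have h := (continuous_gradient hτ).continuousAt (x := x)
    exact ((continuous_gradient hf).continuousAt.norm.pow 2).mul
      (((continuousAt_coeffA_gradient hΦ hf (hs x hx)).clm_apply h).inner h)

end limit

/-! ### The geometric Poincaré inequality. -/

section geometricPoincare

variable {Φ : ℝ → ℝ} {m : ℕ} {u φ g : Fin m → Plane → ℝ} {a : Fin m → Fin m → Plane → ℝ}

/-- The pointwise defect in `∂ⱼHᵢ ∇uᵢ · ∇uⱼ ≤ |∂ⱼHᵢ| |∇uᵢ| |∇uⱼ|`, for `i ≠ j`. -/
noncomputable def couplingDefect (a : Fin m → Fin m → Plane → ℝ) (u : Fin m → Plane → ℝ)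
    (i j : Fin m) (x : Plane) : ℝ :=
  if i = j then 0 else
    |a i j x| * ‖gradient (u i) x‖ * ‖gradient (u j) x‖ -
      a i j x * inner ℝ (gradient (u j) x) (gradient (u i) x)

theorem couplingDefect_nonneg (i j : Fin m) (x : Plane) : 0 ≤ couplingDefect a u i j x := by
  unfold couplingDefect
  split_ifs
  · exact le_rfl
  · have h : a i j x * inner ℝ (gradient (u j) x) (gradient (u i) x) ≤
        |a i j x| * (‖gradient (u j) x‖ * ‖gradient (u i) x‖) :=
      (le_abs_self _).trans (by
        rw [abs_mul]
        exact mul_le_mul_of_nonneg_left (abs_real_inner_le_norm _ _) (abs_nonneg _))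
    linarith

theorem continuous_couplingDefect (hu : ∀ i, ContDiff ℝ 1 (u i)) (ha : ∀ i j, Continuous (a i j))
    (i j : Fin m) : Continuous (couplingDefect a u i j) := by
  unfold couplingDefect
  split_ifs
  · exact continuous_const
  · exact (((ha i j).abs.mul (continuous_gradient (hu i)).norm).mul
      (continuous_gradient (hu j)).norm).sub
        ((ha i j).mul ((continuous_gradient (hu j)).inner (continuous_gradient (hu i))))

/-- The geometric Poincaré inequality for stable solutions. -/
theorem geometric_poincare (hΦ : IsAdmissible Φ) (hu : ∀ i, ContDiff ℝ 1 (u i))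
    (hX : ∀ i, ContDiff ℝ 1 (flux Φ (u i))) (hg : ∀ i, ContDiff ℝ 1 (g i))
    (hug : ∀ i x, -divergence (flux Φ (u i)) x = g i x)
    (hga : ∀ i x v, fderiv ℝ (g i) x v = ∑ j, a i j x * inner ℝ (gradient (u j) x) v)
    (ha : ∀ i j, Continuous (a i j)) (hsymm : ∀ i j x, a i j x = a j i x)
    (hφ : ∀ i, ContDiff ℝ 1 (φ i)) (hφ0 : ∀ i x, φ i x ≠ 0)
    (hpos : ∀ i j, i ≠ j → ∀ x, 0 < a i j x * φ j x * φ i x)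
    (hφa : ∀ i, NegDivEqWeakly (fun x => applyA Φ (gradient (u i) x) (gradient (φ i) x))
      (fun x => ∑ j, a i j x * φ j x))
    {C : ℝ} (hC0 : 0 ≤ C)
    (hC : ∀ i x, gradient (u i) x ≠ 0 → ∀ ξ, ‖gradient (u i) x‖ ^ 2 *
      inner ℝ (coeffA Φ (gradient (u i) x) ξ) ξ ≤ C * ‖ξ‖ ^ 2)
    {η : Plane → ℝ} (hη : ContDiff ℝ 1 η) (hc : HasCompactSupport η) :
    ∑ i, (∫ x, tangentialEnergy Φ (u i) x * η x ^ 2) +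
        ∑ i, ∑ j, (∫ x, couplingDefect a u i j x * η x ^ 2) ≤
      m * (2 * C) * ∫ x, ‖gradient η x‖ ^ 2 := by
  have hcη2 : HasCompactSupport fun x => η x ^ 2 := by
    refine hc.mono fun x hx h => hx ?_
    simp [h]
  have hG := fun i => continuous_gradient (hu i)
  -- Each component is truncated near its own critical points, so the supports differ with `i`.
  let ζ : ℕ → Fin m → Plane → ℝ := fun k i x => ‖gradient (u i) x‖ * truncation (u i) η k x
  let S : (Fin m → ℝ) → Plane → Fin m → Fin m → ℝ := fun z x i j =>
    if i = j then a i j x * z i ^ 2 else |a i j x| * |z i| * |z j|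
  have hζ : ∀ k i, ContDiff ℝ 1 (ζ k i) := fun k i =>
    contDiff_norm_gradient_mul hΦ (hu i) (hX i) (contDiff_truncation hΦ (hu i) (hX i) hη k)
      fun x hx => gradient_ne_zero_of_mem_tsupport_truncation (hu i) hx
  have hcζ : ∀ k i, HasCompactSupport (ζ k i) := fun k i =>
    (hasCompactSupport_truncation hc k).mul_left
  have hsζ : ∀ k i, ∀ x ∈ tsupport (ζ k i), gradient (u i) x ≠ 0 := fun k i x hx =>
    gradient_ne_zero_of_mem_tsupport_truncation (η := η) (k := k) (hu i)
      (closure_mono (Function.support_mul_subset_right _ _) hx)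
  have hζle : ∀ k i x, |ζ k i x| ≤ ‖gradient (u i) x‖ * |η x| := fun k i x => by
    rw [abs_mul, abs_norm]
    exact mul_le_mul_of_nonneg_left (sq_le_sq.1 (truncation_sq_le k x)) (norm_nonneg _)
  have hζlim : ∀ i x, Tendsto (fun k => ζ k i x) atTop (𝓝 (‖gradient (u i) x‖ * η x)) := by
    intro i x
    by_cases hx : gradient (u i) x = 0
    · simp [ζ, hx]
    · refine tendsto_const_nhds.congr' ?_
      filter_upwards [eventually_truncation_eq (η := η) hx] with k hk
      simp only [ζ, hk]
  have hmain : ∀ k, ∫ x, ∑ i, ∑ j, S (fun i => ζ k i x) x i j ≤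
      ∑ i, ((∫ x, fderiv ℝ (g i) x (gradient (u i) x) * truncation (u i) η k x ^ 2) -
        (∫ x, tangentialEnergy Φ (u i) x * truncation (u i) η k x ^ 2) +
        ((∫ x, truncationError Φ (u i) η k x) + 2 * C * ∫ x, ‖gradient η x‖ ^ 2)) := fun k =>
    (stability_inequality hΦ hu ha hsymm hφ hφ0 hpos hφa (hζ k) (hcζ k) (hsζ k)).trans
      (Finset.sum_le_sum fun i _ => integral_inner_coeffA_truncation_le hΦ (hu i) (hX i) (hg i)
        (hug i) hη hc hC0 (hC i) k)
  have hB := fun i => integrable_normalEnergy_mul_sq hΦ (hu i) (hX i) (hg i) (hug i) hη hc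
  have hQ := fun i => integrable_tangentialEnergy_mul_sq hΦ (hu i) (hX i) (hg i) (hug i) hη hc
  have hDc : ∀ i, Continuous fun x => fderiv ℝ (g i) x (gradient (u i) x) := fun i =>
    ((hg i).continuous_fderiv (by norm_num)).clm_apply (hG i)
  have hD : ∀ i, Integrable fun x => fderiv ℝ (g i) x (gradient (u i) x) * η x ^ 2 := fun i =>
    ((hDc i).mul (hη.continuous.pow 2)).integrable_of_hasCompactSupport hcη2.mul_left
  have hRlim := tendsto_finsetSum (Finset.univ : Finset (Fin m)) fun i _ =>
    ((tendsto_integral_mul_truncation_sq hΦ (hu i) (hX i) hη (hD i)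
      (hDc i).aestronglyMeasurable fun x hx => by rw [hx, map_zero]).sub
    (tendsto_integral_mul_truncation_sq hΦ (hu i) (hX i) hη (hQ i)
      (aestronglyMeasurable_of_continuousAt (hu i)
        (fun x hx => continuousAt_tangentialEnergy hΦ (hu i) (hX i) hx)
        fun x hx => tangentialEnergy_eq_zero hx) fun x hx => tangentialEnergy_eq_zero hx)).add
    ((tendsto_integral_truncationError (hu i) (hB i)).add_const
      (2 * C * ∫ x, ‖gradient η x‖ ^ 2))
  have hSlim : Tendsto (fun k => ∫ x, ∑ i, ∑ j, S (fun i => ζ k i x) x i j) atTop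
      (𝓝 (∫ x, ∑ i, ∑ j, S (fun i => ‖gradient (u i) x‖ * η x) x i j)) := by
    refine tendsto_integral_of_dominated_convergence
      (fun x => ∑ i, ∑ j, |a i j x| * (‖gradient (u i) x‖ * |η x|) * (‖gradient (u j) x‖ * |η x|))
      (fun k => ?_) ?_ (fun k => Eventually.of_forall fun x => ?_)
      (Eventually.of_forall fun x => ?_)
    · refine Continuous.aestronglyMeasurable ?_
      refine continuous_finsetSum _ fun i _ => continuous_finsetSum _ fun j _ => ?_
      simp only [S]
      split_ifs
      · exact (ha i j).mul ((hζ k i).continuous.pow 2)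
      · exact ((ha i j).abs.mul (hζ k i).continuous.abs).mul (hζ k j).continuous.abs
    · refine integrable_finsetSum _ fun i _ => integrable_finsetSum _ fun j _ => ?_
      refine Continuous.integrable_of_hasCompactSupport ?_ ?_
      · exact ((ha i j).abs.mul ((hG i).norm.mul hη.continuous.abs)).mul
          ((hG j).norm.mul hη.continuous.abs)
      · refine hc.mono fun x hx h => hx ?_
        simp [h]
    · refine (norm_sum_le _ _).trans (Finset.sum_le_sum fun i _ => ?_)
      refine (norm_sum_le _ _).trans (Finset.sum_le_sum fun j _ => ?_)
      have e : ‖S (fun i => ζ k i x) x i j‖ = |a i j x| * |ζ k i x| * |ζ k j x| := by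
        simp only [S]
        split_ifs with h
        · subst h
          rw [Real.norm_eq_abs, abs_mul, abs_pow]
          ring
        · simp
      rw [e]
      exact mul_le_mul (mul_le_mul_of_nonneg_left (hζle k i x) (abs_nonneg _)) (hζle k j x)
        (abs_nonneg _) (by positivity)
    · refine tendsto_finsetSum _ fun i _ => tendsto_finsetSum _ fun j _ => ?_
      simp only [S]
      split_ifs
      · exact tendsto_const_nhds.mul ((hζlim i x).pow 2)
      · exact (tendsto_const_nhds.mul (hζlim i x).abs).mul (hζlim j x).abs
  have hfinal := le_of_tendsto_of_tendsto' hSlim hRlim hmain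
  have hiD : ∀ i j, Integrable fun x => couplingDefect a u i j x * η x ^ 2 := fun i j =>
    ((continuous_couplingDefect hu ha i j).mul
      (hη.continuous.pow 2)).integrable_of_hasCompactSupport hcη2.mul_left
  -- By the chain rule `∇gᵢ · ∇uᵢ = ∑ⱼ aᵢⱼ ∇uⱼ · ∇uᵢ`. Its diagonal terms coincide with those of
  -- `S`, and the off-diagonal differences are the coupling defects.
  have hS : ∫ x, ∑ i, ∑ j, S (fun i => ‖gradient (u i) x‖ * η x) x i j =
      ∑ i, ∑ j, (∫ x, couplingDefect a u i j x * η x ^ 2) +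
        ∑ i, ∫ x, fderiv ℝ (g i) x (gradient (u i) x) * η x ^ 2 := by
    rw [← integral_finsetSum _ fun i _ => hD i]
    simp_rw [← integral_finsetSum Finset.univ fun j _ => hiD _ j]
    rw [← integral_finsetSum _ fun i _ => integrable_finsetSum _ fun j _ => hiD i j,
      ← integral_add (integrable_finsetSum _ fun i _ => integrable_finsetSum _ fun j _ => hiD i j)
        (integrable_finsetSum _ fun i _ => hD i)]
    refine integral_congr_ae (Eventually.of_forall fun x => ?_)
    dsimp only
    rw [← Finset.sum_add_distrib]
    refine Finset.sum_congr rfl fun i _ => ?_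
    rw [hga, Finset.sum_mul, ← Finset.sum_add_distrib]
    refine Finset.sum_congr rfl fun j _ => ?_
    simp only [S, couplingDefect]
    split_ifs with h
    · subst h
      rw [real_inner_self_eq_norm_sq]
      ring
    · rw [abs_mul, abs_mul, abs_norm, abs_norm]
      rw [← sq_abs (η x)]
      ring
  rw [hS] at hfinal
  simp only [Finset.sum_add_distrib, Finset.sum_sub_distrib, zero_add, Finset.sum_const,
    Finset.card_univ, Fintype.card_fin, nsmul_eq_mul] at hfinal
  linarith

end geometricPoincare

/-! ### Logarithmic cutoffs of small Dirichlet energy. -/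

section logCutoff

theorem exists_sq_deriv_step_le : ∃ C, 0 ≤ C ∧ ∀ t, deriv step t ^ 2 ≤ C := by
  obtain ⟨C, hC⟩ := exists_sq_mul_deriv_step_le
  have hC0 : 0 ≤ C := (sq_nonneg _).trans (hC 0)
  refine ⟨C, hC0, fun t => ?_⟩
  rcases lt_or_ge t 1 with h | h
  · rw [deriv_step_of_lt h]
    simpa using hC0
  · refine le_trans ?_ (hC t)
    rw [mul_pow]
    exact le_mul_of_one_le_left (sq_nonneg _) (one_le_pow₀ h)

/-- The logarithmic cutoff function, `1` where `|x|² ≤ exp L - 1` and `0` where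
`|x|² ≥ exp (2 L) - 1`. -/
noncomputable def logCutoff (L : ℝ) (x : Plane) : ℝ := step (3 - Real.log (1 + ‖x‖ ^ 2) / L)

theorem contDiff_logCutoff (L : ℝ) : ContDiff ℝ 1 (logCutoff L) := by
  have h1 : ContDiff ℝ 1 fun x : Plane => 1 + ‖x‖ ^ 2 := contDiff_const.add (contDiff_norm_sq ℝ)
  have h2 : ContDiff ℝ 1 fun x : Plane => Real.log (1 + ‖x‖ ^ 2) :=
    h1.log fun x => by positivity
  exact contDiff_step.comp (contDiff_const.sub (h2.div_const L))

theorem logCutoff_eq_one {L : ℝ} (hL : 0 < L) {x : Plane}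
    (hx : Real.log (1 + ‖x‖ ^ 2) ≤ L) : logCutoff L x = 1 := by
  refine step_of_ge ?_
  have := (div_le_one hL).2 hx
  linarith

theorem log_lt_of_norm_gt {L : ℝ} {x : Plane} (hx : Real.exp L < ‖x‖) :
    2 * L < Real.log (1 + ‖x‖ ^ 2) := by
  rw [Real.lt_log_iff_exp_lt (by positivity), two_mul, Real.exp_add]
  nlinarith [Real.exp_pos L]

theorem hasCompactSupport_logCutoff {L : ℝ} (hL : 0 < L) : HasCompactSupport (logCutoff L) := by
  refine HasCompactSupport.intro (isCompact_closedBall (0 : Plane) (Real.exp L)) fun x hx => ?_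
  refine step_of_le ?_
  have h := log_lt_of_norm_gt (by simpa using hx : Real.exp L < ‖x‖)
  have := (lt_div_iff₀ hL).2 h
  linarith

theorem sq_norm_gradient_logCutoff_le {C : ℝ} (hC : ∀ t, deriv step t ^ 2 ≤ C)
    {L : ℝ} (hL : 0 < L) (x : Plane) :
    ‖gradient (logCutoff L) x‖ ^ 2 ≤
      4 * C / L ^ 2 * (Iic (Real.exp L)).indicator (fun r => 1 / (1 + r ^ 2)) ‖x‖ := by
  have h1 : HasFDerivAt (fun x : Plane => 1 + ‖x‖ ^ 2) (2 • innerSL ℝ x) x :=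
    (hasStrictFDerivAt_norm_sq x).hasFDerivAt.const_add 1
  have hpos : 0 < 1 + ‖x‖ ^ 2 := by positivity
  have h2 := (h1.log hpos.ne').mul_const L⁻¹
  have h3 : HasFDerivAt (fun x : Plane => 3 - Real.log (1 + ‖x‖ ^ 2) / L) _ x := h2.const_sub 3
  have h4 : HasDerivAt step (deriv step (3 - Real.log (1 + ‖x‖ ^ 2) / L))
      (3 - Real.log (1 + ‖x‖ ^ 2) / L) :=
    (contDiff_step.differentiable (by norm_num) _).hasDerivAt
  have h5 : HasFDerivAt (logCutoff L) _ x := h4.comp_hasFDerivAt x h3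
  have hgrad : gradient (logCutoff L) x =
      (-(2 * deriv step (3 - Real.log (1 + ‖x‖ ^ 2) / L) / ((1 + ‖x‖ ^ 2) * L))) • x := by
    refine ext_inner_right ℝ fun v => ?_
    rw [inner_gradient_left, h5.fderiv, inner_smul_left]
    simp
    field_simp
  by_cases hx : ‖x‖ ≤ Real.exp L
  · rw [indicator_of_mem (by exact hx), hgrad, norm_smul, mul_pow, Real.norm_eq_abs, sq_abs]
    have hCt := hC (3 - Real.log (1 + ‖x‖ ^ 2) / L)
    have hC0 : 0 ≤ C := (sq_nonneg _).trans hCt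
    set d := deriv step (3 - Real.log (1 + ‖x‖ ^ 2) / L)
    calc (-(2 * d / ((1 + ‖x‖ ^ 2) * L))) ^ 2 * ‖x‖ ^ 2
        = 4 * d ^ 2 / L ^ 2 * (‖x‖ ^ 2 / (1 + ‖x‖ ^ 2)) * (1 / (1 + ‖x‖ ^ 2)) := by
          field_simp
          ring
      _ ≤ 4 * C / L ^ 2 * 1 * (1 / (1 + ‖x‖ ^ 2)) := by
          gcongr
          rw [div_le_one hpos]
          linarith
      _ = _ := by rw [mul_one]
  · rw [indicator_of_notMem (by exact hx), mul_zero, hgrad]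
    have h := (lt_div_iff₀ hL).2 (log_lt_of_norm_gt (not_le.1 hx))
    rw [deriv_step_of_lt (by linarith)]
    simp

/-- In polar coordinates the radial integral is `log(1 + exp(2L)) / 2 ≤ (1 + 2L) / 2 ≤ 2L`. The
growth is linear in `L`, against the factor `1 / L²` in the squared gradient of the cutoff. -/
theorem exists_integral_indicator_le :
    ∃ V, 0 ≤ V ∧ ∀ L, 1 ≤ L →
      Integrable (fun x : Plane =>
        (Iic (Real.exp L)).indicator (fun r => 1 / (1 + r ^ 2)) ‖x‖) ∧
      ∫ x : Plane, (Iic (Real.exp L)).indicator (fun r => 1 / (1 + r ^ 2)) ‖x‖ ≤ V * L := by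
  refine ⟨2 * (volume.real (Metric.ball (0 : Plane) 1) * 2), by positivity, fun L hL => ⟨?_, ?_⟩⟩
  · have : Integrable ((Metric.closedBall (0 : Plane) (Real.exp L)).indicator
        fun x : Plane => 1 / (1 + ‖x‖ ^ 2)) := by
      refine (integrable_indicator_iff measurableSet_closedBall).2 ?_
      refine ContinuousOn.integrableOn_compact (isCompact_closedBall _ _) ?_
      exact (continuous_const.div (by fun_prop) fun x => by positivity).continuousOn
    refine this.congr (Eventually.of_forall fun x => ?_)
    by_cases hx : ‖x‖ ≤ Real.exp L
    · simp [indicator, hx]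
    · simp [indicator, hx]
  · rw [integral_fun_norm_addHaar volume]
    have hI : ∫ y in Ioi (0 : ℝ), y ^ (Module.finrank ℝ Plane - 1) •
        (Iic (Real.exp L)).indicator (fun r => 1 / (1 + r ^ 2)) y ≤ 2 * L := by
      have e : ∀ y : ℝ, y ^ (Module.finrank ℝ Plane - 1) •
          (Iic (Real.exp L)).indicator (fun r => 1 / (1 + r ^ 2)) y =
          (Iic (Real.exp L)).indicator (fun r => r / (1 + r ^ 2)) y := by
        intro y
        by_cases hy : y ≤ Real.exp L
        · simp [indicator, hy, div_eq_mul_inv]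
        · simp [indicator, hy]
      simp_rw [e]
      rw [setIntegral_indicator measurableSet_Iic, Ioi_inter_Iic,
        ← intervalIntegral.integral_of_le (Real.exp_pos L).le]
      have hderiv : ∀ y : ℝ, HasDerivAt (fun y => Real.log (1 + y ^ 2) / 2) (y / (1 + y ^ 2)) y := by
        intro y
        have hp : 1 + y ^ 2 ≠ 0 := by positivity
        have h := (((hasDerivAt_id y).pow 2).const_add 1).log hp
        refine (h.div_const 2).congr_deriv ?_
        simp
        field_simp
      rw [intervalIntegral.integral_eq_sub_of_hasDerivAt (fun y _ => hderiv y)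
        (Continuous.intervalIntegrable
          (continuous_id.div (by fun_prop) fun y => by positivity) _ _)]
      have hlog : Real.log (1 + Real.exp L ^ 2) ≤ 1 + 2 * L := by
        rw [Real.log_le_iff_le_exp (by positivity), Real.exp_add, two_mul, Real.exp_add]
        have h1 : 2 ≤ Real.exp 1 := by linarith [Real.add_one_le_exp (1 : ℝ)]
        have h2 : 1 ≤ Real.exp L := Real.one_le_exp (by linarith)
        nlinarith [mul_nonneg (sub_nonneg.2 h1) (sq_nonneg (Real.exp L)), mul_self_nonneg (Real.exp L - 1)]
      simp
      linarith
    have hV : 0 ≤ volume.real (Metric.ball (0 : Plane) 1) := measureReal_nonneg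
    have hf : Module.finrank ℝ Plane = 2 := by simp
    rw [hf] at hI ⊢
    simp only [nsmul_eq_mul, smul_eq_mul, Nat.cast_ofNat] at hI ⊢
    have := mul_le_mul_of_nonneg_left hI hV
    linarith

/-- Points have zero capacity at infinity in the plane. -/
theorem exists_cutoff (R : ℝ) {δ : ℝ} (hδ : 0 < δ) :
    ∃ η : Plane → ℝ, ContDiff ℝ 1 η ∧ HasCompactSupport η ∧ (∀ x, ‖x‖ ≤ R → η x = 1) ∧
      ∫ x, ‖gradient η x‖ ^ 2 ≤ δ := by
  obtain ⟨C, hC0, hC⟩ := exists_sq_deriv_step_le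
  obtain ⟨V, hV0, hV⟩ := exists_integral_indicator_le
  -- The three lower bounds on `L` serve the linear growth estimate, the value `1` on the ball of
  -- radius `R`, and the energy bound `4 C V / L ≤ δ`.
  obtain ⟨L, hL⟩ : ∃ L : ℝ, max 1 (max (Real.log (1 + R ^ 2)) (4 * C * V / δ)) ≤ L := ⟨_, le_rfl⟩
  have hL1 : 1 ≤ L := (le_max_left _ _).trans hL
  have hL2 : Real.log (1 + R ^ 2) ≤ L := (le_max_left _ _).trans ((le_max_right _ _).trans hL)
  have hL3 : 4 * C * V / δ ≤ L := (le_max_right _ _).trans ((le_max_right _ _).trans hL)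
  have hL0 : 0 < L := zero_lt_one.trans_le hL1
  refine ⟨logCutoff L, contDiff_logCutoff L, hasCompactSupport_logCutoff hL0, fun x hx => ?_, ?_⟩
  · refine logCutoff_eq_one hL0 (le_trans ?_ hL2)
    gcongr
  · calc ∫ x, ‖gradient (logCutoff L) x‖ ^ 2
        ≤ ∫ x : Plane, 4 * C / L ^ 2 *
            (Iic (Real.exp L)).indicator (fun r => 1 / (1 + r ^ 2)) ‖x‖ :=
          integral_mono_ae (integrable_norm_gradient_sq (contDiff_logCutoff L)
            (hasCompactSupport_logCutoff hL0)) ((hV L hL1).1.const_mul _)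
            (Eventually.of_forall fun x => sq_norm_gradient_logCutoff_le hC hL0 x)
      _ ≤ 4 * C / L ^ 2 * (V * L) := by
          rw [integral_const_mul]
          exact mul_le_mul_of_nonneg_left (hV L hL1).2 (by positivity)
      _ = 4 * C * V / L := by field_simp
      _ ≤ δ := by
          rw [div_le_iff₀ hL0]
          rw [div_le_iff₀ hδ] at hL3
          linarith

end logCutoff

/-! ### From small Dirichlet energy to pointwise vanishing. -/

section vanishing

/-- If `F x₀ > 0`, then `F > F x₀ / 2` on a ball. Cutoffs equal to `1` there keep the left side
above a fixed `c > 0`, while their Dirichlet energy can be made arbitrarily small. -/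
theorem eq_zero_of_integral_mul_sq_le {F : Plane → ℝ} {C : ℝ} (hF0 : ∀ x, 0 ≤ F x)
    (hFi : ∀ η : Plane → ℝ, ContDiff ℝ 1 η → HasCompactSupport η →
      Integrable fun x => F x * η x ^ 2)
    (hFC : ∀ η : Plane → ℝ, ContDiff ℝ 1 η → HasCompactSupport η →
      ∫ x, F x * η x ^ 2 ≤ C * ∫ x, ‖gradient η x‖ ^ 2)
    {x₀ : Plane} (hF : ContinuousAt F x₀) : F x₀ = 0 := by
  by_contra hne
  have hpos : 0 < F x₀ := lt_of_le_of_ne (hF0 x₀) (Ne.symm hne)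
  obtain ⟨r, hr, hball⟩ := Metric.eventually_nhds_iff_ball.1
    (hF.eventually (lt_mem_nhds (half_lt_self hpos)))
  have hV : 0 < volume.real (Metric.ball x₀ r) :=
    ENNReal.toReal_pos (Metric.measure_ball_pos volume x₀ hr).ne' measure_ball_lt_top.ne
  set c := F x₀ / 2 * volume.real (Metric.ball x₀ r)
  have hc : 0 < c := mul_pos (half_pos hpos) hV
  obtain ⟨η, hη, hηc, hη1, hηδ⟩ := exists_cutoff (‖x₀‖ + r)
    (div_pos hc (by positivity : 0 < 2 * (|C| + 1)))
  have h1 : c ≤ ∫ x, F x * η x ^ 2 := by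
    have e : ∫ x, (Metric.ball x₀ r).indicator (fun _ => F x₀ / 2) x = c := by
      rw [integral_indicator_const _ measurableSet_ball, smul_eq_mul, mul_comm]
    rw [← e]
    refine integral_mono_ae ?_ (hFi η hη hηc) (Eventually.of_forall fun x => ?_)
    · exact (integrable_indicator_iff measurableSet_ball).2
        (integrableOn_const measure_ball_lt_top.ne)
    · by_cases hx : x ∈ Metric.ball x₀ r
      · have hxn : ‖x‖ ≤ ‖x₀‖ + r := by
          have h2 := norm_sub_norm_le x x₀
          have h3 := mem_ball_iff_norm.1 hx
          linarith
        simp only [indicator_of_mem hx, hη1 x hxn, one_pow, mul_one]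
        exact (hball x hx).le
      · rw [indicator_of_notMem hx]
        exact mul_nonneg (hF0 x) (sq_nonneg _)
  have hI : 0 ≤ ∫ x, ‖gradient η x‖ ^ 2 := integral_nonneg fun x => sq_nonneg _
  have h2 : C * ∫ x, ‖gradient η x‖ ^ 2 ≤ (|C| + 1) * (c / (2 * (|C| + 1))) :=
    mul_le_mul (by linarith [le_abs_self C]) hηδ hI (by positivity)
  have h3 : (|C| + 1) * (c / (2 * (|C| + 1))) = c / 2 := by field_simp
  linarith [hFC η hη hηc]

end vanishing

/-! ### Gradients that are constant along straight level lines. -/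

section levelLines

variable {G : Plane → Plane}

theorem rot_sub (v w : Plane) : rot (v - w) = rot v - rot w := by
  ext k
  fin_cases k
  · simp [rot]; ring
  · simp [rot]

/-- Grönwall's inequality on a segment, without integrating the level curve. As `DG(y)` kills `rot
(G y)`, the vector `rot (G q)` may be replaced by `rot (G q - G y)`, so the derivative of `G y - G
q` along the segment is bounded by a multiple of `|G y - G q|`. -/
theorem eventually_eq_along_rot (hG : ∀ x, G x ≠ 0 → ContDiffAt ℝ 1 G x)
    (hrot : ∀ x, G x ≠ 0 → fderiv ℝ G x (rot (G x)) = 0) {q : Plane} (hq : G q ≠ 0) :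
    ∃ r > 0, ∀ t : ℝ, |t| < r → G (q + t • rot (G q)) = G q := by
  have hMc : ContinuousAt (fderiv ℝ G) q := (hG q hq).continuousAt_fderiv (by norm_num)
  obtain ⟨ρ, hρ, hball⟩ := Metric.eventually_nhds_iff_ball.1
    ((hMc.norm.eventually (gt_mem_nhds (lt_add_one ‖fderiv ℝ G q‖))).and
      ((hG q hq).continuousAt.eventually_ne hq))
  set K := ‖fderiv ℝ G q‖ + 1
  have hK : 0 < K := by positivity
  have hn : 0 < ‖G q‖ := norm_pos_iff.2 hq
  refine ⟨ρ / ‖G q‖, div_pos hρ hn, fun t ht => ?_⟩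
  rw [lt_div_iff₀ hn] at ht
  have hmem : ∀ s ∈ Icc (0 : ℝ) 1, q + s • t • rot (G q) ∈ Metric.ball q ρ := fun s hs => by
    rw [mem_ball_iff_norm, add_sub_cancel_left, norm_smul, norm_smul, norm_rot,
      Real.norm_of_nonneg hs.1, Real.norm_eq_abs]
    exact (mul_le_of_le_one_left (by positivity) hs.2).trans_lt ht
  have hderiv : ∀ s ∈ Icc (0 : ℝ) 1, HasDerivAt (fun s : ℝ => G (q + s • t • rot (G q)) - G q)
      (fderiv ℝ G (q + s • t • rot (G q)) (t • rot (G q))) s := fun s hs => by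
    have h1 : HasDerivAt (fun s : ℝ => q + s • t • rot (G q)) (t • rot (G q)) s := by
      simpa using ((hasDerivAt_id s).smul_const (t • rot (G q))).const_add q
    have h2 := ((hG _ (hball _ (hmem s hs)).2).differentiableAt (by norm_num)).hasFDerivAt
    exact (h2.comp_hasDerivAt s h1).sub_const _
  have h := eq_zero_of_abs_deriv_le_mul_abs_self_of_eq_zero_right (a := 0) (b := 1)
    (f := fun s : ℝ => G (q + s • t • rot (G q)) - G q)
    (f' := fun s => fderiv ℝ G (q + s • t • rot (G q)) (t • rot (G q))) (K := |t| * K)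
    (fun s hs => (hderiv s hs).continuousAt.continuousWithinAt)
    (fun s hs => (hderiv s (Ico_subset_Icc_self hs)).hasDerivWithinAt) (by simp)
    (fun s hs => ?_) 1 (by simp)
  · simpa [sub_eq_zero] using h
  · have hb := hball _ (hmem s (Ico_subset_Icc_self hs))
    set y := q + s • t • rot (G q)
    have e : fderiv ℝ G y (t • rot (G q)) = -(t • fderiv ℝ G y (rot (G y - G q))) := by
      rw [rot_sub, map_sub, hrot y hb.2, map_smul, zero_sub, smul_neg, neg_neg]
    rw [e, norm_neg, norm_smul, mul_assoc, Real.norm_eq_abs]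
    refine mul_le_mul_of_nonneg_left ?_ (abs_nonneg _)
    refine (ContinuousLinearMap.le_opNorm _ _).trans ?_
    rw [norm_rot]
    exact mul_le_mul_of_nonneg_right hb.1.le (norm_nonneg _)

/-- A gradient that does not change in the direction of the level curves is constant along
entire straight lines. -/
theorem eq_along_rot (hGc : Continuous G) (hG : ∀ x, G x ≠ 0 → ContDiffAt ℝ 1 G x)
    (hrot : ∀ x, G x ≠ 0 → fderiv ℝ G x (rot (G x)) = 0) {p : Plane} (hp : G p ≠ 0) (t : ℝ) :
    G (p + t • rot (G p)) = G p := by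
  have hclosed : IsClosed {t : ℝ | G (p + t • rot (G p)) = G p} :=
    isClosed_eq (hGc.comp (by fun_prop)) continuous_const
  have hopen : IsOpen {t : ℝ | G (p + t • rot (G p)) = G p} := by
    refine Metric.isOpen_iff.2 fun t₀ ht₀ => ?_
    have ht₀' : G (p + t₀ • rot (G p)) = G p := ht₀
    -- At the new base point `G` has its old value, so the local result applies along the same line;
    -- the set is thus open as well as closed in `ℝ`.
    obtain ⟨r, hr, h⟩ := eventually_eq_along_rot hG hrot (q := p + t₀ • rot (G p))
      (by rwa [ht₀'])
    refine ⟨r, hr, fun s hs => ?_⟩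
    have h1 := h (s - t₀) (by simpa [Real.dist_eq] using hs)
    rw [ht₀', add_assoc, ← add_smul, add_sub_cancel] at h1
    exact h1
  have huniv := (IsClopen.eq_univ ⟨hclosed, hopen⟩ ⟨0, by simp⟩ :
    {t : ℝ | G (p + t • rot (G p)) = G p} = univ)
  exact (eq_univ_iff_forall.1 huniv t)

theorem inner_rot (v w : Plane) : inner ℝ (rot v) w = v 0 * w 1 - v 1 * w 0 := by
  rw [inner_eq_sum_mul]
  simp [rot, Fin.sum_univ_two]
  ring

theorem inner_eq (v w : Plane) : inner ℝ v w = v 0 * w 0 + v 1 * w 1 := by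
  rw [inner_eq_sum_mul, Fin.sum_univ_two]

theorem inner_rot_sq_add_inner_sq (v w : Plane) :
    inner ℝ (rot v) w ^ 2 + inner ℝ v w ^ 2 = ‖v‖ ^ 2 * ‖w‖ ^ 2 := by
  rw [← real_inner_self_eq_norm_sq, ← real_inner_self_eq_norm_sq, inner_rot, inner_eq, inner_eq,
    inner_eq]
  ring

/-- Lines that are not parallel meet. -/
theorem exists_add_smul_rot_eq {v w : Plane} (h : inner ℝ (rot v) w ≠ 0) (p q : Plane) :
    ∃ s t : ℝ, p + s • rot v = q + t • rot w := by
  -- Cramer's rule: pairing the equation with `w` eliminates `t`, and pairing it with `v` eliminates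
  -- `s`.
  refine ⟨inner ℝ (q - p) w / inner ℝ (rot v) w, inner ℝ (q - p) v / inner ℝ (rot v) w, ?_⟩
  obtain ⟨D, hD⟩ : ∃ D, D = inner ℝ (rot v) w := ⟨_, rfl⟩
  rw [← hD] at h ⊢
  rw [inner_rot] at hD
  rw [inner_eq, inner_eq]
  ext k
  fin_cases k
  · simp [rot]
    field_simp
    rw [hD]
    ring
  · simp [rot]
    field_simp
    rw [hD]
    ring

theorem eq_inner_smul_add (a x : Plane) (ha : ‖a‖ = 1) :
    x = inner ℝ a x • a + inner ℝ (rot a) x • rot a := by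
  have h : a 0 * a 0 + a 1 * a 1 = 1 := by
    rw [← inner_eq, real_inner_self_eq_norm_sq, ha, one_pow]
  rw [inner_eq, inner_rot]
  ext k
  fin_cases k
  · simp [rot]
    linear_combination (-x 0) * h
  · simp [rot]
    linear_combination (-x 1) * h

/-- `f` has zero derivative along `rot a`, so it is constant on each line orthogonal to `a` and
determined by its values on the line through `a`. -/
theorem exists_eq_comp_inner {f : Plane → ℝ} (hf : Differentiable ℝ f) {a : Plane}
    (ha : ‖a‖ = 1) (h : ∀ x, inner ℝ (rot a) (gradient f x) = 0) :
    ∃ g : ℝ → ℝ, ∀ x, f x = g (inner ℝ a x) := by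
  refine ⟨fun s => f (s • a), fun x => ?_⟩
  have hderiv : ∀ t : ℝ, HasDerivAt (fun t : ℝ => f (inner ℝ a x • a + t • rot a)) 0 t := by
    intro t
    have h1 : HasDerivAt (fun t : ℝ => inner ℝ a x • a + t • rot a) (rot a) t := by
      simpa using ((hasDerivAt_id t).smul_const (rot a)).const_add (inner ℝ a x • a)
    have h2 := (hf (inner ℝ a x • a + t • rot a)).hasFDerivAt.comp_hasDerivAt t h1
    rwa [← inner_gradient_left, real_inner_comm (rot a) (gradient f _), h] at h2
  have hconst := is_const_of_deriv_eq_zero (fun t => (hderiv t).differentiableAt)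
    (fun t => (hderiv t).deriv) (inner ℝ (rot a) x) 0
  dsimp only at hconst ⊢
  conv_lhs => rw [eq_inner_smul_add a x ha]
  rw [hconst, zero_smul, add_zero]

end levelLines

/-! ### Rigidity, the common direction and the main theorem. -/

theorem exists_norm_le_of_memLp_top {n : ℕ}
    {G : EuclideanSpace ℝ (Fin n) → EuclideanSpace ℝ (Fin n)} (hG : Continuous G)
    (h : MemLp (fun x => ‖G x‖) ⊤ volume) : ∃ K, ∀ x, ‖G x‖ ≤ K := by
  have hlt := h.eLpNorm_lt_top
  rw [eLpNorm_exponent_top] at hlt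
  refine ⟨(eLpNormEssSup (fun x => ‖G x‖) volume).toReal, fun x => ?_⟩
  have hae : ∀ᵐ y, ‖G y‖ ≤ (eLpNormEssSup (fun x => ‖G x‖) volume).toReal := by
    filter_upwards [ae_le_eLpNormEssSup (f := fun x => ‖G x‖) (μ := volume)] with y hy
    rw [← ENNReal.toReal_ofReal (norm_nonneg (G y))]
    refine ENNReal.toReal_mono hlt.ne ?_
    rwa [ofReal_norm, ← enorm_norm]
  -- The set where the bound fails is open and null, hence empty.
  have hopen : IsOpen {y | (eLpNormEssSup (fun x => ‖G x‖) volume).toReal < ‖G y‖} :=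
    isOpen_lt continuous_const hG.norm
  by_contra hx
  have hne := hopen.measure_pos volume ⟨x, not_le.1 hx⟩
  refine hne.ne' ?_
  have h0 := ae_iff.1 hae
  simpa only [not_le] using h0

theorem fderiv_comp_eq_sum {m n : ℕ} {h : (Fin m → ℝ) → ℝ} (hh : ContDiff ℝ 1 h)
    {u : Fin m → EuclideanSpace ℝ (Fin n) → ℝ} (hu : ∀ i, ContDiff ℝ 1 (u i))
    (x v : EuclideanSpace ℝ (Fin n)) :
    fderiv ℝ (fun x => h fun k => u k x) x v =
      ∑ j, partialDeriv j h (fun k => u k x) * inner ℝ (gradient (u j) x) v := by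
  have hU : HasFDerivAt (fun x k => u k x) (ContinuousLinearMap.pi fun k => fderiv ℝ (u k) x) x :=
    hasFDerivAt_pi.2 fun k => ((hu k).differentiable (by norm_num) x).hasFDerivAt
  have hc : HasFDerivAt (fun x => h fun k => u k x) _ x :=
    (hh.differentiable (by norm_num) (fun k => u k x)).hasFDerivAt.comp x hU
  rw [hc.fderiv, ContinuousLinearMap.comp_apply,
    ← Finset.univ_sum_single ((ContinuousLinearMap.pi fun k => fderiv ℝ (u k) x) v), map_sum]
  refine Finset.sum_congr rfl fun j _ => ?_
  rw [inner_gradient_left, ContinuousLinearMap.pi_apply, partialDeriv]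
  have e : (Pi.single j (fderiv ℝ (u j) x v) : Fin m → ℝ) =
      fderiv ℝ (u j) x v • Pi.single j (1 : ℝ) := by
    rw [← Pi.single_smul, smul_eq_mul, mul_one]
  rw [e, map_smul, smul_eq_mul, mul_comm]

/-- A stable solution has gradients that do not change along level curves, and the gradients of
any two components are parallel. -/
theorem rigidity {m : ℕ} {Φ : ℝ → ℝ} (hΦ : IsAdmissible Φ) {H : Fin m → (Fin m → ℝ) → ℝ}
    (hH : ∀ i, ContDiff ℝ 1 (H i)) (hsymm : IsSymmetricSystem H) {u : Fin m → Plane → ℝ}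
    (hu : IsClassicalSolution Φ H u) (hstable : IsStable Φ H u)
    (hgrad : ∀ i, ∃ K, ∀ x, ‖gradient (u i) x‖ ≤ K) :
    (∀ i x, gradient (u i) x ≠ 0 →
      fderiv ℝ (gradient (u i)) x (rot (gradient (u i) x)) = 0) ∧
    ∀ i j, i ≠ j → ∀ x, partialDeriv j (H i) (fun k => u k x) ≠ 0 ∧
      |partialDeriv j (H i) (fun k => u k x)| * ‖gradient (u i) x‖ * ‖gradient (u j) x‖ =
        partialDeriv j (H i) (fun k => u k x) *
          inner ℝ (gradient (u j) x) (gradient (u i) x) := by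
  obtain ⟨φ, hφ, hφs, hpos, hφa⟩ := hstable
  have hφ0 : ∀ i x, φ i x ≠ 0 := fun i x => by
    rcases hφs i with h | h
    · exact (h x).ne'
    · exact (h x).ne
  have hu1 : ∀ i, ContDiff ℝ 1 (u i) := fun i => (hu i).1
  have hX : ∀ i, ContDiff ℝ 1 (flux Φ (u i)) := fun i => (hu i).2.1
  have hU : ContDiff ℝ 1 fun x k => u k x := contDiff_pi.2 hu1
  let g : Fin m → Plane → ℝ := fun i x => H i fun k => u k x
  let a : Fin m → Fin m → Plane → ℝ := fun i j x => partialDeriv j (H i) fun k => u k x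
  have hg : ∀ i, ContDiff ℝ 1 (g i) := fun i => (hH i).comp hU
  have hug : ∀ i x, -divergence (flux Φ (u i)) x = g i x := fun i => (hu i).2.2
  have ha : ∀ i j, Continuous (a i j) := fun i j =>
    (((hH i).continuous_fderiv (by norm_num)).comp hU.continuous).clm_apply continuous_const
  choose K hK using hgrad
  choose C hC0 hC using fun i => exists_sq_norm_mul_inner_coeffA_le (n := 2) hΦ (K i)
  have hC' : ∀ i x, gradient (u i) x ≠ 0 → ∀ ξ, ‖gradient (u i) x‖ ^ 2 *
      inner ℝ (coeffA Φ (gradient (u i) x) ξ) ξ ≤ (∑ i, C i) * ‖ξ‖ ^ 2 := fun i x hx ξ =>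
    (hC i _ hx (hK i x) ξ).trans (mul_le_mul_of_nonneg_right
      (Finset.single_le_sum (fun j _ => hC0 j) (Finset.mem_univ i)) (sq_nonneg _))
  have hpoincare : ∀ η : Plane → ℝ, ContDiff ℝ 1 η → HasCompactSupport η →
      ∑ i, (∫ x, tangentialEnergy Φ (u i) x * η x ^ 2) +
        ∑ i, ∑ j, (∫ x, couplingDefect a u i j x * η x ^ 2) ≤
      m * (2 * ∑ i, C i) * ∫ x, ‖gradient η x‖ ^ 2 := fun η hη hc =>
    geometric_poincare hΦ hu1 hX hg hug (fun i x v => fderiv_comp_eq_sum (hH i) hu1 x v) ha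
      (fun i j x => hsymm _ j i) hφ hφ0 hpos hφa (Finset.sum_nonneg fun i _ => hC0 i) hC' hη hc
  have hQ0 : ∀ (η : Plane → ℝ) i, 0 ≤ ∫ x, tangentialEnergy Φ (u i) x * η x ^ 2 := fun η i =>
    integral_nonneg fun x => mul_nonneg (tangentialEnergy_nonneg hΦ (hu1 i) (hX i) x) (sq_nonneg _)
  have hD0 : ∀ (η : Plane → ℝ) i j, 0 ≤ ∫ x, couplingDefect a u i j x * η x ^ 2 := fun η i j =>
    integral_nonneg fun x => mul_nonneg (couplingDefect_nonneg i j x) (sq_nonneg _)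
  constructor
  · intro i x hx
    have hzero : tangentialEnergy Φ (u i) x = 0 := by
      refine eq_zero_of_integral_mul_sq_le (C := m * (2 * ∑ i, C i))
        (tangentialEnergy_nonneg hΦ (hu1 i) (hX i))
        (fun η hη hc => integrable_tangentialEnergy_mul_sq hΦ (hu1 i) (hX i) (hg i) (hug i) hη hc)
        (fun η hη hc => ?_) (continuousAt_tangentialEnergy hΦ (hu1 i) (hX i) hx)
      have h1 := Finset.single_le_sum (fun j _ => hQ0 η j) (Finset.mem_univ i)
      have h2 := Finset.sum_nonneg fun i (_ : i ∈ Finset.univ) =>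
        Finset.sum_nonneg fun j (_ : j ∈ Finset.univ) => hD0 η i j
      linarith [hpoincare η hη hc]
    -- The tangential energy is `𝒜w · w / |∇uᵢ|²` for `w` the derivative of `∇uᵢ` along `rot ∇uᵢ`;
    -- definiteness forces `w = 0`.
    by_contra hne
    have hpos' := inner_coeffA_self_pos hΦ hx hne
    rw [← fderiv_flux hΦ (hu1 i) (hX i) hx] at hpos'
    have : 0 < ‖gradient (u i) x‖ ^ 2 := by positivity
    exact (div_pos hpos' this).ne' hzero
  · intro i j hij x
    have hzero : couplingDefect a u i j x = 0 := by
      have hcont := continuous_couplingDefect hu1 ha i j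
      refine eq_zero_of_integral_mul_sq_le (C := m * (2 * ∑ i, C i)) (couplingDefect_nonneg i j)
        (fun η hη hc => ?_) (fun η hη hc => ?_) hcont.continuousAt
      · refine (hcont.mul (hη.continuous.pow 2)).integrable_of_hasCompactSupport ?_
        refine hc.mono fun x hx h => hx ?_
        simp [h]
      · have h1 := Finset.sum_nonneg fun i (_ : i ∈ Finset.univ) => hQ0 η i
        have h2 := Finset.single_le_sum (fun j _ => hD0 η i j) (Finset.mem_univ j)
        have h3 := Finset.single_le_sum (fun i _ => Finset.sum_nonneg fun j
          (_ : j ∈ Finset.univ) => hD0 η i j) (Finset.mem_univ i)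
        linarith [hpoincare η hη hc]
    rw [couplingDefect, if_neg hij, sub_eq_zero] at hzero
    refine ⟨fun h0 => ?_, hzero⟩
    have := hpos i j hij x
    rw [h0] at this
    simp at this

/-- Take `a` along one nonzero gradient. A gradient not parallel to it has a level line crossing
that of the first. At the crossing both gradients keep their values, and there they coincide (`i =
j`) or are parallel (`hpar`), a contradiction. If all gradients vanish, any unit vector serves. -/
theorem exists_direction {m : ℕ} {u : Fin m → Plane → ℝ}
    (hline : ∀ i p, gradient (u i) p ≠ 0 → ∀ t : ℝ,
      gradient (u i) (p + t • rot (gradient (u i) p)) = gradient (u i) p)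
    (hpar : ∀ i j, i ≠ j → ∀ x, inner ℝ (gradient (u i) x) (gradient (u j) x) ^ 2 =
      ‖gradient (u i) x‖ ^ 2 * ‖gradient (u j) x‖ ^ 2) :
    ∃ a : Plane, ‖a‖ = 1 ∧ ∀ j q, inner ℝ (rot a) (gradient (u j) q) = 0 := by
  by_cases h : ∃ i p, gradient (u i) p ≠ 0
  · obtain ⟨i, p, hp⟩ := h
    have hn : ‖gradient (u i) p‖ ≠ 0 := norm_ne_zero_iff.2 hp
    refine ⟨‖gradient (u i) p‖⁻¹ • gradient (u i) p, ?_, fun j q => ?_⟩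
    · rw [norm_smul, norm_inv, norm_norm, inv_mul_cancel₀ hn]
    · have key : inner ℝ (rot (gradient (u i) p)) (gradient (u j) q) = 0 := by
        by_contra hne
        have hq : gradient (u j) q ≠ 0 := fun h0 => hne (by rw [h0, inner_zero_right])
        obtain ⟨s, t, hst⟩ := exists_add_smul_rot_eq hne p q
        have h1 := hline i p hp s
        have h2 := hline j q hq t
        rw [← hst] at h2
        rcases eq_or_ne i j with rfl | hij
        · rw [h1] at h2
          rw [← h2, inner_rot_self] at hne
          exact hne rfl
        · have h3 := hpar i j hij (p + s • rot (gradient (u i) p))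
          rw [h1, h2] at h3
          have h4 := inner_rot_sq_add_inner_sq (gradient (u i) p) (gradient (u j) q)
          rw [h3] at h4
          exact hne (pow_eq_zero_iff two_ne_zero |>.1 (by linarith))
      rw [inner_rot] at key ⊢
      simp only [PiLp.smul_apply, smul_eq_mul]
      linear_combination ‖gradient (u i) p‖⁻¹ * key
  · push Not at h
    exact ⟨EuclideanSpace.single 0 1, by simp, fun j q => by rw [h j q, inner_zero_right]⟩

end QuasilinearSystem

theorem theorem4p3 (m : ℕ) (Φ : ℝ → ℝ) (hΦ : QuasilinearSystem.IsAdmissible Φ)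
    (H : Fin m → (Fin m → ℝ) → ℝ) (hH : ∀ i, ContDiff ℝ 1 (H i))
    (hsymm : QuasilinearSystem.IsSymmetricSystem H)
    (u : Fin m → EuclideanSpace ℝ (Fin 2) → ℝ)
    (hu : QuasilinearSystem.IsClassicalSolution Φ H u)
    (hbdd : ∀ i, ∃ M : ℝ, ∀ x, |u i x| ≤ M)
    (hstable : QuasilinearSystem.IsStable Φ H u)
    (hgrad : ∀ i, MemLp (fun x => ‖gradient (u i) x‖) ⊤ volume)
    (hgradW : ∀ i, QuasilinearSystem.MemW12Loc (fun x => ‖gradient (u i) x‖)) :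
    (∃ a : EuclideanSpace ℝ (Fin 2), ‖a‖ = 1 ∧
      ∀ i, ∃ ustar : ℝ → ℝ, ∀ x, u i x = ustar (inner ℝ a x)) ∧
    ∀ i j, i ≠ j → ∀ x, gradient (u i) x ≠ 0 → gradient (u j) x ≠ 0 →
      InnerProductGeometry.angle (gradient (u i) x) (gradient (u j) x) =
        Real.arccos (|QuasilinearSystem.partialDeriv i (H j) (fun k => u k x)| /
          QuasilinearSystem.partialDeriv i (H j) (fun k => u k x)) := by
  open QuasilinearSystem in
  have hu1 : ∀ i, ContDiff ℝ 1 (u i) := fun i => (hu i).1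
  obtain ⟨hrot, hcouple⟩ := rigidity hΦ hH hsymm hu hstable fun i =>
    exists_norm_le_of_memLp_top (continuous_gradient (hu1 i)) (hgrad i)
  have hcouple' : ∀ i j, i ≠ j → ∀ x, inner ℝ (gradient (u i) x) (gradient (u j) x) ^ 2 =
      ‖gradient (u i) x‖ ^ 2 * ‖gradient (u j) x‖ ^ 2 := by
    intro i j hij x
    obtain ⟨h0, h1⟩ := hcouple i j hij x
    have h2 := congrArg (· ^ 2) h1
    simp only [mul_pow, sq_abs, mul_assoc] at h2
    rw [real_inner_comm]
    -- The coupling coefficient is nonzero by stability, so its square cancels and equality in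
    -- Cauchy–Schwarz remains.
    exact (mul_left_cancel₀ (pow_ne_zero 2 h0) h2).symm
  refine ⟨?_, fun i j hij x hi hj => ?_⟩
  · obtain ⟨a, ha, h⟩ := exists_direction (fun i p hp t => eq_along_rot
      (continuous_gradient (hu1 i))
      (fun x hx => contDiffAt_gradient hΦ (hu1 i) (hu i).2.1 hx) (hrot i) hp t) hcouple'
    exact ⟨a, ha, fun i =>
      exists_eq_comp_inner ((hu1 i).differentiable (by norm_num)) ha (h i)⟩
  · obtain ⟨h0, h1⟩ := hcouple i j hij x
    rw [InnerProductGeometry.angle, hsymm _ i j]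
    congr 1
    have hi' : ‖gradient (u i) x‖ ≠ 0 := norm_ne_zero_iff.2 hi
    have hj' : ‖gradient (u j) x‖ ≠ 0 := norm_ne_zero_iff.2 hj
    -- Dividing the vanishing-defect identity by `∂ⱼHᵢ |∇uᵢ| |∇uⱼ|` gives the cosine of the angle.
    rw [real_inner_comm, div_eq_div_iff (mul_ne_zero hi' hj') h0]
    linarith
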